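/- Let $\Psi\in C^1([1,\infty))$ satisfy $\Psi>0$ and $\Psi'>0$ on $[1,\infty)$, and suppose that $\Psi$ is convex on $[R_0,\infty)$ for some $R_0>1$. Let $N\ge 1$ be any dimension and write $B_R=\{x\in\mathbb{R}^N:|x|<R\}$. Then the following three conditions are equivalent. (i) (Property (P)) Whenever $\varphi\in L^\infty_{loc}(\mathbb{R}^N)$ is positive and $\sigma\in H^1_{loc}(\mathbb{R}^N)$ satisfies $\sigma\,\mathrm{div}(\varphi^2\nabla\sigma)\ge 0$ in $\mathbb{R}^N$ in the distributional sense, i.e. $-\int_{\mathbb{R}^N}\varphi^2\,\nabla\sigma\cdot\nabla(\eta\sigma)\,dx\ge 0$ for every $0\le\eta\in C_c^\infty(\mathbb{R}^N)$, together with $\int_{B_R}(\varphi\sigma)^2\,dx\le\Psi(R)$ for every $R\ge 1$, the function $\sigma$ is (almost everywhere equal to a) constant. (ii) (Property (P')) Whenever $\varphi\in L^\infty_{loc}(\mathbb{R}^N)$ is positive and $\sigma\in H^1_{loc}(\mathbb{R}^N)$ satisfies $\mathrm{div}(\varphi^2\nabla\sigma)=0$ in $\mathbb{R}^N$ in the distributional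 sense, i.e. $\int_{\mathbb{R}^N}\varphi^2\,\nabla\sigma\cdot\nabla\eta\,dx=0$ for every $\eta\in C_c^\infty(\mathbb{R}^N)$, together with $\int_{B_R}(\varphi\sigma)^2\,dx\le\Psi(R)$ for every $R\ge 1$, the function $\sigma$ is (almost everywhere equal to a) constant. (iii') $\displaystyle\int_1^\infty\frac{dr}{\Psi'(r)}=\infty$. -/

import Mathlib

open MeasureTheory Set
open scoped ENNReal ContDiff

/-- `ℝ^N` with its Euclidean norm. -/
abbrev RN (N : ℕ) : Type := EuclideanSpace ℝ (Fin N)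

/-- Membership in `L^p_loc(ℝ^N)`: the function is in `L^p(K)` for every compact `K`. -/
def MemLpLoc {N : ℕ} {F : Type} [NormedAddCommGroup F] (f : RN N → F) (p : ℝ≥0∞) : Prop :=
  ∀ K : Set (RN N), IsCompact K → MemLp f p (volume.restrict K)

/-- Test functions on `ℝ^N`: real-valued, smooth, with compact support. -/
def IsTestFun {N : ℕ} (η : RN N → ℝ) : Prop :=
  ContDiff ℝ ∞ η ∧ HasCompactSupport η

/-- `G` is the weak (distributional) gradient of `σ`:
`∫ σ ∂_v η = - ∫ (G · v) η` for every test function `η` and every direction `v`. -/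
def IsWeakGradient {N : ℕ} (σ : RN N → ℝ) (G : RN N → RN N) : Prop :=
  ∀ η : RN N → ℝ, IsTestFun η → ∀ v : RN N,
    ∫ x, σ x * fderiv ℝ η x v = -∫ x, inner ℝ (G x) v * η x

/-- `σ ∈ H¹_loc(ℝ^N)` with `∇σ = G`: both `σ` and its weak gradient `G` are in `L²_loc`. -/
def IsH1Loc {N : ℕ} (σ : RN N → ℝ) (G : RN N → RN N) : Prop :=
  MemLpLoc σ 2 ∧ MemLpLoc G 2 ∧ IsWeakGradient σ G

/-- `div (φ² ∇σ) = 0` in the distributional sense, where `G = ∇σ`. -/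
def DivEqZero {N : ℕ} (φ : RN N → ℝ) (G : RN N → RN N) : Prop :=
  ∀ η : RN N → ℝ, IsTestFun η →
    ∫ x, φ x ^ 2 * inner ℝ (G x) (gradient η x) = 0

/-- `σ div (φ² ∇σ) ≥ 0` in the distributional sense, where `G = ∇σ`: for every nonnegative test
function `η`, the distribution `div (φ² ∇σ)` takes a nonnegative value on `η σ`, that is
`-∫ φ² ∇σ · ∇(η σ) ≥ 0`, where `∇(η σ) = η ∇σ + σ ∇η`. -/
def MulDivNonneg {N : ℕ} (φ σ : RN N → ℝ) (G : RN N → RN N) : Prop :=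
  ∀ η : RN N → ℝ, IsTestFun η → (∀ x, 0 ≤ η x) →
    0 ≤ -∫ x, φ x ^ 2 * inner ℝ (G x) (η x • G x + σ x • gradient η x)

/-- `∫_{B_R} (φ σ)² ≤ Ψ(R)` for every `R ≥ 1`. -/
def GrowthBound {N : ℕ} (Ψ : ℝ → ℝ) (φ σ : RN N → ℝ) : Prop :=
  ∀ R : ℝ, 1 ≤ R → ∫ x in Metric.ball (0 : RN N) R, (φ x * σ x) ^ 2 ≤ Ψ R

/-- Equality to a constant, almost everywhere. -/
def IsAEConst {N : ℕ} (σ : RN N → ℝ) : Prop :=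
  ∃ c : ℝ, ∀ᵐ x : RN N, σ x = c

/-- Property (P) in dimension `N`. -/
def PropertyP (N : ℕ) (Ψ : ℝ → ℝ) : Prop :=
  ∀ (φ σ : RN N → ℝ) (G : RN N → RN N),
    MemLpLoc φ ⊤ → (∀ᵐ x : RN N, 0 < φ x) → IsH1Loc σ G →
    MulDivNonneg φ σ G → GrowthBound Ψ φ σ → IsAEConst σ

/-- Property (P') in dimension `N`. -/
def PropertyP' (N : ℕ) (Ψ : ℝ → ℝ) : Prop :=
  ∀ (φ σ : RN N → ℝ) (G : RN N → RN N),
    MemLpLoc φ ⊤ → (∀ᵐ x : RN N, 0 < φ x) → IsH1Loc σ G →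
    DivEqZero φ G → GrowthBound Ψ φ σ → IsAEConst σ

/-! ### The growth function -/

/-! Write `μ = (φσ)² dx`, so that the growth bound reads `μ(B_R) ≤ Ψ(R)`.

Divergence of `∫ 1/Ψ'` gives (P). Testing with `η = ζ²` yields the Caccioppoli inequality `∫
φ²ζ²|∇σ|² ≤ 4 ∫ |∇ζ|² dμ` (`MulDivNonneg.caccioppoli`). The cutoff adapted to `Ψ` is `ζ =
θ(Q(r)/Q(T))`, where `Q` is a primitive of a smooth `q` comparable to `1/Ψ'` and `r` is a smoothed
radius; then `|∇ζ| ≤ C / (Q(T) Ψ'(r))`. By convexity `1/Ψ'²` is decreasing past `R₀`, so its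
`μ`-integral is largest when the radial distribution of `μ` is `dΨ` itself, and then it is a
constant plus `∫ Ψ'/Ψ'² = ∫ 1/Ψ'`, which is `O(1 + Q(T))` (`lintegral_inv_sq_le`). The energy is
thus `O((1 + Q(T))/Q(T)²)`, which tends to zero because `Q(T) → ∞`; hence `∇σ = 0`.

(P) gives (P') because a solution of `div(φ²∇σ) = 0` may be tested with `ησ`. This function is only
`H¹` with compact support, so it is reached by mollification (`DivEqZero.mulDivNonneg`).

(P') gives divergence by a counterexample. If `∫ 1/Ψ'` converges, let `u` be a primitive of
`1/Ψ'(|t|)` (with `Ψ'` frozen near `0`), `σ = u(x_j)`, and `φ²` a multiple of `Ψ'(|x_j|)` times a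
Gaussian in the other variables. The flux `φ²∇σ` does not vary along its own direction, so it is
divergence free; `u` is bounded, and the mass in `B_R` is at most a multiple of `∫_{-R}^{R} Ψ'(|t|)
dt`, hence of `Ψ(R)`. -/

theorem integral_derivWithin_Ici_one {Ψ : ℝ → ℝ} (hΨ : ContDiffOn ℝ 1 Ψ (Ici 1)) {a b : ℝ}
    (ha : 1 ≤ a) (hab : a ≤ b) :
    ∫ t in a..b, derivWithin Ψ (Ici 1) t = Ψ b - Ψ a := by
  have hc : ContinuousOn (derivWithin Ψ (Ici 1)) (Ici 1) :=
    hΨ.continuousOn_derivWithin (uniqueDiffOn_Ici 1) le_rfl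
  have hsub : Icc a b ⊆ Ici 1 := fun x hx => ha.trans hx.1
  refine intervalIntegral.integral_eq_sub_of_hasDerivAt_of_le hab (hΨ.continuousOn.mono hsub)
    (fun x hx => ?_) ?_
  · have hx1 : (1 : ℝ) < x := ha.trans_lt hx.1
    have := (hΨ.differentiableOn one_ne_zero x hx1.le).hasDerivWithinAt
    exact this.hasDerivAt (Ici_mem_nhds hx1)
  · apply ContinuousOn.intervalIntegrable
    rw [uIcc_of_le hab]
    exact hc.mono hsub

/-- This is where convexity enters: it makes the weight `1/Ψ'²` decreasing past `R₀`, as the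
layer-cake comparison requires. Since `R₀ > 1`, the one-sided derivative at `1` plays no role. -/
theorem monotoneOn_derivWithin_Ici_one {Ψ : ℝ → ℝ} (hΨ : ContDiffOn ℝ 1 Ψ (Ici 1)) {R₀ : ℝ}
    (hR₀ : 1 < R₀) (hconv : ConvexOn ℝ (Ici R₀) Ψ) :
    MonotoneOn (derivWithin Ψ (Ici 1)) (Ici R₀) := by
  have key : ∀ x ∈ Ici R₀, derivWithin Ψ (Ici 1) x = deriv Ψ x := fun x hx =>
    derivWithin_of_mem_nhds (Ici_mem_nhds (hR₀.trans_le hx))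
  have hd : ∀ x ∈ Ici R₀, DifferentiableAt ℝ Ψ x := fun x hx =>
    (hΨ.differentiableOn one_ne_zero x (hR₀.le.trans hx)).differentiableAt
      (Ici_mem_nhds (hR₀.trans_le hx))
  exact (hconv.monotoneOn_deriv hd).congr fun x hx => (key x hx).symm

/-- Layer-cake comparison: if `μ {r < t}` is at most `M + ∫_{R₀}^t ψ` with `ψ` monotone, then the
weight `1 / ψ(r)²` integrates to at most what the extremal radial distribution gives. -/
theorem lintegral_inv_sq_le {α : Type*} [MeasurableSpace α] (μ : Measure α) {r : α → ℝ}
    (hr : Measurable r) {ψ : ℝ → ℝ} (hψ : Continuous ψ) (hψ0 : ∀ t, 0 < ψ t) {R₀ T M : ℝ}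
    (hmono : Monotone ψ) (hconst : ∀ t ≤ R₀, ψ t = ψ R₀) (hT : R₀ < T) (hM : 0 ≤ M)
    (hμ : ∀ t, R₀ ≤ t → μ {x | r x < t} ≤ ENNReal.ofReal (M + ∫ s in R₀..t, ψ s)) :
    ∫⁻ x in {x | r x < T}, ENNReal.ofReal (1 / ψ (r x) ^ 2) ∂μ ≤
      ENNReal.ofReal (M / ψ R₀ ^ 2 + ∫ s in R₀..T, 1 / ψ s) := by
  set k : ℝ → ℝ := (Iio T).indicator (fun t => 1 / ψ t ^ 2) with hk
  have hcont : Continuous fun t => 1 / ψ t ^ 2 :=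
    continuous_const.div (hψ.pow 2) fun t => (pow_pos (hψ0 t) 2).ne'
  have hkm : Measurable k := hcont.measurable.indicator measurableSet_Iio
  have hk0 : ∀ t, 0 ≤ k t := indicator_nonneg fun t _ => by have := hψ0 t; positivity
  have hanti : ∀ s t, s ≤ t → k t ≤ k s := by
    intro s t hst
    by_cases ht : t < T
    · have hs : s < T := hst.trans_lt ht
      simp only [hk, indicator_of_mem (show t ∈ Iio T from ht),
        indicator_of_mem (show s ∈ Iio T from hs)]
      exact one_div_le_one_div_of_le (pow_pos (hψ0 s) 2)
        (pow_le_pow_left₀ (hψ0 s).le (hmono hst) 2)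
    · simp only [hk, indicator_of_notMem (show t ∉ Iio T from ht)]
      exact hk0 s
  have hkR : ∀ t, k t ≤ k R₀ := by
    intro t
    rcases le_total t R₀ with h | h
    · simp only [hk, indicator_of_mem (show t ∈ Iio T from h.trans_lt hT),
        indicator_of_mem (show R₀ ∈ Iio T from hT), hconst t h, le_refl]
    · exact hanti _ _ h
  -- The extremal radial distribution: it attains the assumed bound on every half-line `(-∞, b)`
  -- with `b > R₀`. Against its density `ψ` the weight `1/ψ²` becomes `1/ψ`.
  set ν : Measure ℝ := ENNReal.ofReal M • Measure.dirac R₀ +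
    (volume.restrict (Ici R₀)).withDensity (fun t => ENNReal.ofReal (ψ t)) with hν
  have hψm : Measurable fun t => ENNReal.ofReal (ψ t) := hψ.measurable.ennreal_ofReal
  have hinterval : ∀ b, R₀ ≤ b → ∀ f : ℝ → ℝ, Continuous f → (∀ t, 0 ≤ f t) →
      ∫⁻ t in Ico R₀ b, ENNReal.ofReal (f t) = ENNReal.ofReal (∫ t in R₀..b, f t) := by
    intro b hb f hf hf0
    rw [intervalIntegral.integral_of_le hb, integral_Ioc_eq_integral_Ioo,
      ← integral_Ico_eq_integral_Ioo, ofReal_integral_eq_lintegral_ofReal]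
    · exact (hf.integrableOn_Icc (a := R₀) (b := b)).mono_set Ico_subset_Icc_self
    · exact Filter.Eventually.of_forall hf0
  have hνb : ∀ b, R₀ < b → ν (Iio b) = ENNReal.ofReal (M + ∫ s in R₀..b, ψ s) := by
    intro b hb
    rw [ENNReal.ofReal_add hM (intervalIntegral.integral_nonneg hb.le fun t _ => (hψ0 t).le),
      ← hinterval b hb.le ψ hψ fun t => (hψ0 t).le]
    simp only [hν, Measure.add_apply, Measure.smul_apply, smul_eq_mul,
      withDensity_apply _ measurableSet_Iio, Measure.restrict_restrict measurableSet_Iio]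
    rw [Measure.dirac_apply' _ measurableSet_Iio, indicator_of_mem (show R₀ ∈ Iio b from hb),
      Pi.one_apply, mul_one, inter_comm, Ici_inter_Iio]
  have hlevel : ∀ s, 0 < s → μ {x | s < k (r x)} ≤ ν {t | s < k t} := by
    intro s hs
    by_cases hsR : s < k R₀
    · set A : Set ℝ := {t | s < k t} with hA
      have hAT : ∀ t ∈ A, t < T := by
        intro t ht
        by_contra h
        have : k t = 0 := indicator_of_notMem (show t ∉ Iio T from h) _
        have ht' : s < k t := ht
        rw [this] at ht'
        exact lt_asymm hs ht'
      have hAo : IsOpen A := by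
        have : A = Iio T ∩ {t | s < 1 / ψ t ^ 2} := by
          ext t
          constructor
          · intro ht
            have h1 := hAT t ht
            refine ⟨h1, ?_⟩
            simpa [hA, hk, indicator_of_mem (show t ∈ Iio T from h1)] using ht
          · rintro ⟨h1, h2⟩
            simpa [hA, hk, indicator_of_mem h1] using h2
        rw [this]
        exact isOpen_Iio.inter (isOpen_lt continuous_const hcont)
      have hbdd : BddAbove A := ⟨T, fun t ht => (hAT t ht).le⟩
      have hRA : R₀ ∈ A := hsR
      -- The superlevel set of the decreasing weight is open and closed downwards, so it is an open
      -- half-line, on which `μ` and `ν` can be compared.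
      have hAb : A = Iio (sSup A) := by
        ext t
        constructor
        · intro ht
          obtain ⟨ε, hε, hball⟩ := Metric.isOpen_iff.1 hAo t ht
          have : t + ε / 2 ∈ A := hball (by
            rw [Metric.mem_ball, Real.dist_eq, add_sub_cancel_left, abs_of_pos (by positivity)]
            linarith)
          exact lt_of_lt_of_le (by linarith) (le_csSup hbdd this)
        · intro ht
          obtain ⟨u, hu, htu⟩ := exists_lt_of_lt_csSup ⟨R₀, hRA⟩ ht
          exact lt_of_lt_of_le hu (hanti _ _ htu.le)
      have hRb : R₀ < sSup A := by
        have := hRA; rw [hAb] at this; exact this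
      have h1 : {x | s < k (r x)} = {x | r x < sSup A} := by
        ext x
        have : r x ∈ A ↔ r x ∈ Iio (sSup A) := by rw [← hAb]
        exact this
      have h2 : ν A = ENNReal.ofReal (M + ∫ s in R₀..sSup A, ψ s) :=
        (congrArg ν hAb).trans (hνb _ hRb)
      rw [h1, h2]
      exact hμ _ hRb.le
    · have : {x | s < k (r x)} = ∅ := by
        ext x
        simpa using (hkR (r x)).trans (not_lt.1 hsR)
      rw [this, measure_empty]
      exact zero_le
  have hset : MeasurableSet {x | r x < T} := measurableSet_lt hr measurable_const
  calc ∫⁻ x in {x | r x < T}, ENNReal.ofReal (1 / ψ (r x) ^ 2) ∂μ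
      = ∫⁻ x, ENNReal.ofReal (k (r x)) ∂μ := by
        rw [← lintegral_indicator hset]
        refine lintegral_congr fun x => ?_
        by_cases hx : r x < T
        · simp [hk, indicator_of_mem (show x ∈ {x | r x < T} from hx),
            indicator_of_mem (show r x ∈ Iio T from hx)]
        · simp [hk, indicator_of_notMem (show x ∉ {x | r x < T} from hx),
            indicator_of_notMem (show r x ∉ Iio T from hx)]
    _ = ∫⁻ s in Ioi 0, μ {x | s < k (r x)} :=
        lintegral_eq_lintegral_meas_lt μ (Filter.Eventually.of_forall fun x => hk0 _)
          (hkm.comp hr).aemeasurable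
    _ ≤ ∫⁻ s in Ioi 0, ν {t | s < k t} := by
        refine setLIntegral_mono' measurableSet_Ioi fun s hs => hlevel s hs
    _ = ∫⁻ t, ENNReal.ofReal (k t) ∂ν :=
        (lintegral_eq_lintegral_meas_lt ν (Filter.Eventually.of_forall hk0)
          hkm.aemeasurable).symm
    _ = ENNReal.ofReal M * ENNReal.ofReal (1 / ψ R₀ ^ 2) +
          ∫⁻ t in Ico R₀ T, ENNReal.ofReal (1 / ψ t) := by
        rw [hν, lintegral_add_measure, lintegral_smul_measure,
          lintegral_dirac' _ hkm.ennreal_ofReal, smul_eq_mul,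
          lintegral_withDensity_eq_lintegral_mul _ hψm hkm.ennreal_ofReal]
        congr 1
        · simp [hk, indicator_of_mem (show R₀ ∈ Iio T from hT)]
        · rw [← lintegral_indicator measurableSet_Ici, ← lintegral_indicator measurableSet_Ico]
          refine lintegral_congr fun t => ?_
          by_cases h1 : t ∈ Ici R₀
          · by_cases h2 : t ∈ Iio T
            · rw [indicator_of_mem h1, indicator_of_mem (show t ∈ Ico R₀ T from ⟨h1, h2⟩)]
              simp only [hk, Pi.mul_apply, indicator_of_mem h2]
              rw [← ENNReal.ofReal_mul (hψ0 t).le]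
              congr 1
              have := (hψ0 t).ne'
              field_simp
            · rw [indicator_of_mem h1, indicator_of_notMem (fun h => h2 h.2)]
              simp [hk, indicator_of_notMem h2]
          · rw [indicator_of_notMem h1, indicator_of_notMem (fun h => h1 h.1)]
    _ = ENNReal.ofReal (M / ψ R₀ ^ 2 + ∫ s in R₀..T, 1 / ψ s) := by
        have hc1 : Continuous fun t => 1 / ψ t :=
          continuous_const.div hψ fun t => (hψ0 t).ne'
        have hp : ∀ t, 0 ≤ 1 / ψ t := fun t => (one_div_pos.2 (hψ0 t)).le
        rw [hinterval T hT.le _ hc1 hp, ← ENNReal.ofReal_mul hM, ← ENNReal.ofReal_add]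
        · congr 2; ring
        · have := hψ0 R₀; positivity
        · exact intervalIntegral.integral_nonneg hT.le fun t _ => hp t

/-! ### Mollification of functions with a weak gradient -/

open scoped Convolution Topology
open ContinuousLinearMap Filter

variable {N : ℕ}

theorem MemLpLoc.locallyIntegrable {F : Type} [NormedAddCommGroup F] {f : RN N → F}
    (hf : MemLpLoc f 2) : LocallyIntegrable f := by
  rw [locallyIntegrable_iff]
  intro K hK
  have : IsFiniteMeasure (volume.restrict K) := ⟨by simpa using hK.measure_lt_top⟩
  exact (hf K hK).integrable (by norm_num)

theorem MemLpLoc.aestronglyMeasurable {F : Type} [NormedAddCommGroup F] {f : RN N → F}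
    {p : ℝ≥0∞} (hf : MemLpLoc f p) : AEStronglyMeasurable f := by
  have h := aestronglyMeasurable_iUnion_iff (μ := volume) (f := f)
    (s := fun n : ℕ => Metric.closedBall (0 : RN N) n) |>.2
    fun n => (hf _ (isCompact_closedBall _ _)).1
  rwa [Metric.iUnion_closedBall_nat, Measure.restrict_univ] at h

/-- A product of a continuous compactly supported function and a locally integrable function. -/
theorem MeasureTheory.LocallyIntegrable.integrable_mul_of_hasCompactSupport {f g : RN N → ℝ}
    (hf : LocallyIntegrable f) (hg : Continuous g) (hg' : HasCompactSupport g) :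
    Integrable fun x => f x * g x := by
  simpa [mul_comm] using hf.integrable_smul_left_of_hasCompactSupport hg hg'

theorem IsTestFun.comp_sub_left {η : RN N → ℝ} (hη : IsTestFun η) (x : RN N) :
    IsTestFun fun y => η (x - y) :=
  ⟨hη.1.comp (contDiff_const.sub contDiff_id), hη.2.comp_homeomorph (Homeomorph.subLeft x)⟩

theorem ContDiffBump.isTestFun_normed (b : ContDiffBump (0 : RN N)) :
    IsTestFun (b.normed volume) :=
  ⟨b.contDiff_normed, b.hasCompactSupport_normed⟩

theorem IsTestFun.mul {η θ : RN N → ℝ} (hη : ContDiff ℝ ∞ η) (hθ : IsTestFun θ) :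
    IsTestFun fun x => η x * θ x :=
  ⟨hη.mul hθ.1, hθ.2.mul_left⟩

/-- The derivative of the mollification is the mollification of the weak gradient. -/
theorem IsWeakGradient.fderiv_convolution_apply {w : RN N → ℝ} {W : RN N → RN N}
    (hw : LocallyIntegrable w) (hW : IsWeakGradient w W) {ρ : RN N → ℝ} (hρ : IsTestFun ρ)
    (x v : RN N) :
    fderiv ℝ (w ⋆[lsmul ℝ ℝ, volume] ρ) x v = ∫ y, inner ℝ (W y) v * ρ (x - y) := by
  have h1 : ContDiff ℝ 1 ρ := hρ.1.of_le (by exact_mod_cast le_top)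
  rw [(hρ.2.hasFDerivAt_convolution_right (lsmul ℝ ℝ) hw h1 x).fderiv,
    convolution_precompR_apply _ hw (hρ.2.fderiv ℝ) (h1.continuous_fderiv one_ne_zero)]
  -- The reflected translate `y ↦ ρ (x - y)` serves as test function; the sign from the chain rule
  -- cancels the sign in the definition of the weak gradient.
  have h2 := hW _ (hρ.comp_sub_left x) v
  have h3 : ∀ y, fderiv ℝ (fun y => ρ (x - y)) y v = - fderiv ℝ ρ (x - y) v := by
    intro y
    have h4 := ((h1.differentiable one_ne_zero (x - y)).hasFDerivAt.comp y
      ((hasFDerivAt_id y).const_sub x)).fderiv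
    rw [show (fun y => ρ (x - y)) = ρ ∘ HSub.hSub x from rfl, h4]
    simp
  simp only [h3, mul_neg, integral_neg, neg_inj] at h2
  rw [← h2]
  rfl

theorem IsTestFun.convolution {w : RN N → ℝ} (hw : LocallyIntegrable w)
    (hws : HasCompactSupport w) {ρ : RN N → ℝ} (hρ : IsTestFun ρ) :
    IsTestFun (w ⋆[lsmul ℝ ℝ, volume] ρ) :=
  ⟨hρ.2.contDiff_convolution_right (lsmul ℝ ℝ) hw hρ.1, hws.convolution (lsmul ℝ ℝ) hρ.2⟩

/-- A sequence of bump functions concentrating at the origin. -/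
theorem exists_bump_seq (N : ℕ) : ∃ b : ℕ → ContDiffBump (0 : RN N),
    Tendsto (fun n => (b n).rOut) atTop (𝓝 0) ∧ ∀ n, (b n).rOut ≤ 2 * (b n).rIn := by
  -- The bounded ratio `rOut / rIn = 2` is what makes Lebesgue differentiation give convergence
  -- almost everywhere.
  refine ⟨fun n => ⟨1 / ((n : ℝ) + 1) / 2, 1 / ((n : ℝ) + 1), by positivity, ?_⟩, ?_, ?_⟩
  · exact half_lt_self (by positivity)
  · exact tendsto_one_div_add_atTop_nhds_zero_nat
  · intro n; dsimp only; linarith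

/-- A function whose weak gradient vanishes is almost everywhere constant. -/
theorem IsWeakGradient.isAEConst {σ : RN N → ℝ} {G : RN N → RN N} (hσ : LocallyIntegrable σ)
    (hG : IsWeakGradient σ G) (hG0 : ∀ᵐ x, G x = 0) : IsAEConst σ := by
  obtain ⟨b, hb, hb'⟩ := exists_bump_seq N
  have hae := ContDiffBump.ae_convolution_tendsto_right_of_locallyIntegrable (μ := volume) hb
    (Eventually.of_forall hb') hσ
  -- Each mollification has zero derivative, hence is constant; so is the almost everywhere limit.
  have hconst : ∀ n x, ((b n).normed volume ⋆[lsmul ℝ ℝ, volume] σ) x =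
      ((b n).normed volume ⋆[lsmul ℝ ℝ, volume] σ) 0 := by
    intro n x
    have hflip : ((b n).normed volume ⋆[lsmul ℝ ℝ, volume] σ) =
        (σ ⋆[lsmul ℝ ℝ, volume] (b n).normed volume) := by
      rw [← convolution_flip]
      congr 1
      ext; simp
    rw [hflip]
    have hρ := (b n).isTestFun_normed
    have hdiff : Differentiable ℝ (σ ⋆[lsmul ℝ ℝ, volume] (b n).normed volume) :=
      (hρ.2.contDiff_convolution_right (lsmul ℝ ℝ) hσ hρ.1).differentiable (by simp)
    refine is_const_of_fderiv_eq_zero hdiff (fun y => ?_) x 0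
    ext v
    rw [hG.fderiv_convolution_apply hσ hρ]
    simp only [zero_apply]
    refine integral_eq_zero_of_ae ?_
    filter_upwards [hG0] with z hz
    simp [hz]
  obtain ⟨x₀, hx₀⟩ := hae.exists
  refine ⟨σ x₀, ?_⟩
  filter_upwards [hae] with x hx
  refine tendsto_nhds_unique hx ?_
  refine hx₀.congr fun n => ?_
  rw [hconst n x, hconst n x₀]

/-- The correlation of two square integrable functions is continuous. -/
theorem continuous_integral_inner_sub {A W : RN N → RN N} (hA : MemLp A 2) (hW : MemLp W 2) :
    Continuous fun t : RN N => ∫ x, inner ℝ (A x) (W (x - t)) := by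
  have hmp : ∀ t : RN N, MeasurePreserving (fun x : RN N => x - t) volume volume :=
    fun t => measurePreserving_sub_right volume t
  have hfact : Fact ((2 : ℝ≥0∞) ≠ ⊤) := ⟨by norm_num⟩
  have hcont : Continuous fun t : RN N =>
      ((hW.comp_measurePreserving (hmp t)).toLp (W ∘ fun x => x - t) : Lp (RN N) 2 volume) := by
    let g : C(RN N, C(RN N, RN N)) :=
      (ContinuousMap.mk (fun a : RN N × RN N => a.2 - a.1) (by fun_prop)).curry
    exact (continuous_const (y := hW.toLp W)).compMeasurePreservingLp g.continuous hmp
      (by norm_num)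
  have h := (continuous_const (y := hA.toLp A)).inner (𝕜 := ℝ) hcont
  refine h.congr fun t => ?_
  rw [L2.inner_def]
  refine integral_congr_ae ?_
  filter_upwards [hA.coeFn_toLp, (hW.comp_measurePreserving (hmp t)).coeFn_toLp] with x h1 h2
  rw [h1, h2]; rfl

/-- The integrand is dominated by `|ρ(t)| (|A(x)|² + |W(x - t)|²)`, and both terms are integrable on
the product. This licenses Fubini when a field is paired with a mollified gradient. -/
theorem integrable_smul_inner_sub {A W : RN N → RN N} (hA : MemLp A 2) (hW : MemLp W 2)
    {ρ : RN N → ℝ} (hρ : IsTestFun ρ) :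
    Integrable (fun p : RN N × RN N => ρ p.2 * inner ℝ (A p.1) (W (p.1 - p.2)))
      (volume.prod volume) := by
  have hρi : Integrable ρ := hρ.1.continuous.integrable_of_hasCompactSupport hρ.2
  have hm : AEStronglyMeasurable
      (fun p : RN N × RN N => ρ p.2 * inner ℝ (A p.1) (W (p.1 - p.2))) (volume.prod volume) := by
    have h1 : AEStronglyMeasurable (fun p : RN N × RN N => ρ p.2 • W (p.1 - p.2))
        (volume.prod volume) :=
      hρi.aestronglyMeasurable.convolution_integrand (lsmul ℝ ℝ) hW.1
    have h2 : AEStronglyMeasurable (fun p : RN N × RN N => A p.1) (volume.prod volume) :=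
      hA.1.comp_fst
    refine (h2.inner (𝕜 := ℝ) h1).congr (Eventually.of_forall fun p => ?_)
    simp [inner_smul_right]
  have hA2 : Integrable fun x => ‖A x‖ ^ 2 := hA.integrable_norm_pow (by norm_num)
  have hW2 : Integrable fun x => ‖W x‖ ^ 2 := hW.integrable_norm_pow (by norm_num)
  have hb1 : Integrable (fun p : RN N × RN N => ‖A p.1‖ ^ 2 * |ρ p.2|) (volume.prod volume) :=
    hA2.mul_prod hρi.abs
  have hb2 : Integrable (fun p : RN N × RN N => |ρ p.2| * ‖W (p.1 - p.2)‖ ^ 2)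
      (volume.prod volume) :=
    hρi.abs.convolution_integrand (mul ℝ ℝ) hW2
  refine (hb1.add hb2).mono' hm (Eventually.of_forall fun p => ?_)
  have h1 := norm_inner_le_norm (𝕜 := ℝ) (A p.1) (W (p.1 - p.2))
  have h2 : ‖A p.1‖ * ‖W (p.1 - p.2)‖ ≤ ‖A p.1‖ ^ 2 + ‖W (p.1 - p.2)‖ ^ 2 := by
    nlinarith [sq_nonneg (‖A p.1‖ - ‖W (p.1 - p.2)‖), sq_nonneg ‖A p.1‖,
      sq_nonneg ‖W (p.1 - p.2)‖]
  rw [norm_mul, Real.norm_eq_abs]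
  calc |ρ p.2| * ‖inner ℝ (A p.1) (W (p.1 - p.2))‖
      ≤ |ρ p.2| * (‖A p.1‖ ^ 2 + ‖W (p.1 - p.2)‖ ^ 2) :=
        mul_le_mul_of_nonneg_left (h1.trans h2) (abs_nonneg _)
    _ = _ := by simp only [Pi.add_apply]; ring

/-! ### Testing the equation with `η σ` -/

theorem Continuous.memLp_top_of_isCompact {F : Type} [NormedAddCommGroup F] {f : RN N → F}
    (hf : Continuous f) {K : Set (RN N)} (hK : IsCompact K) : MemLp f ⊤ (volume.restrict K) := by
  obtain ⟨C, hC⟩ := hK.exists_bound_of_continuousOn hf.continuousOn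
  exact memLp_top_of_bound hf.aestronglyMeasurable C
    ((ae_restrict_iff' hK.measurableSet).2 (Eventually.of_forall hC))

theorem MemLpLoc.memLp_of_eq_zero {F : Type} [NormedAddCommGroup F] {f : RN N → F} {p : ℝ≥0∞}
    (hf : MemLpLoc f p) {K : Set (RN N)} (hK : IsCompact K) (h0 : ∀ x ∉ K, f x = 0) :
    MemLp f p := by
  have h1 := (memLp_indicator_iff_restrict hK.measurableSet).2 (hf K hK)
  rwa [indicator_eq_self.2 fun x hx => by_contra fun h => hx (h0 x h)] at h1

theorem Continuous.smul_memLpLoc {F : Type} [NormedAddCommGroup F] [NormedSpace ℝ F]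
    {f : RN N → F} {η : RN N → ℝ} (hη : Continuous η) (hf : MemLpLoc f 2) :
    MemLpLoc (fun x => η x • f x) 2 :=
  fun K hK => (hf K hK).smul (hη.memLp_top_of_isCompact hK)

theorem MemLpLoc.smul_continuous {F : Type} [NormedAddCommGroup F] [NormedSpace ℝ F]
    {f : RN N → ℝ} {V : RN N → F} (hf : MemLpLoc f 2) (hV : Continuous V) :
    MemLpLoc (fun x => f x • V x) 2 :=
  fun K hK => (hV.memLp_top_of_isCompact hK).smul (hf K hK)

theorem MemLpLoc.top_smul {F : Type} [NormedAddCommGroup F] [NormedSpace ℝ F]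
    {φ : RN N → ℝ} {f : RN N → F} (hφ : MemLpLoc φ ⊤) (hf : MemLpLoc f 2) :
    MemLpLoc (fun x => φ x • f x) 2 :=
  fun K hK => (hf K hK).smul (hφ K hK)

theorem MemLpLoc.top_sq_smul {F : Type} [NormedAddCommGroup F] [NormedSpace ℝ F]
    {φ : RN N → ℝ} {f : RN N → F} (hφ : MemLpLoc φ ⊤) (hf : MemLpLoc f 2) :
    MemLpLoc (fun x => φ x ^ 2 • f x) 2 := by
  simpa only [smul_smul, ← sq] using hφ.top_smul (hφ.top_smul hf)

theorem MemLpLoc.locallyIntegrable_mul {f g : RN N → ℝ} (hf : MemLpLoc f 2)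
    (hg : MemLpLoc g 2) : LocallyIntegrable fun x => f x * g x := by
  rw [locallyIntegrable_iff]
  intro K hK
  exact (hf K hK).integrable_mul (hg K hK)

theorem real_inner_gradient_right (f : RN N → ℝ) (x v : RN N) :
    inner ℝ v (gradient f x) = fderiv ℝ f x v := by
  rw [real_inner_comm, gradient, InnerProductSpace.toDual_symm_apply]

theorem IsTestFun.continuous_gradient {η : RN N → ℝ} (hη : IsTestFun η) :
    Continuous (gradient η) :=
  (InnerProductSpace.toDual ℝ (RN N)).symm.continuous.comp
    (hη.1.continuous_fderiv (by simp))

theorem gradient_eq_zero_of_notMem_tsupport {η : RN N → ℝ} {x : RN N} (hx : x ∉ tsupport η) :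
    gradient η x = 0 := by
  have : fderiv ℝ η x = 0 := by
    by_contra h
    exact hx (support_fderiv_subset ℝ h)
  rw [gradient, this, map_zero]

/-- The product rule for a test function and a function with a weak gradient. -/
theorem IsH1Loc.isWeakGradient_mul {σ : RN N → ℝ} {G : RN N → RN N} (hσ : IsH1Loc σ G)
    {η : RN N → ℝ} (hη : IsTestFun η) :
    IsWeakGradient (fun x => η x * σ x) fun x => η x • G x + σ x • gradient η x := by
  intro θ hθ v
  obtain ⟨h1, h2, h3⟩ := hσ
  have hL := h1.locallyIntegrable
  have hcθ : Continuous fun x => fderiv ℝ θ x v :=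
    (hθ.1.continuous_fderiv (by simp)).clm_apply continuous_const
  have hcη : Continuous fun x => fderiv ℝ η x v :=
    (hη.1.continuous_fderiv (by simp)).clm_apply continuous_const
  have key := h3 _ (IsTestFun.mul hη.1 hθ) v
  have hd : ∀ x, fderiv ℝ (fun x => η x * θ x) x v =
      η x * fderiv ℝ θ x v + θ x * fderiv ℝ η x v := by
    intro x
    rw [fderiv_fun_mul (hη.1.differentiable (by simp) x) (hθ.1.differentiable (by simp) x)]
    simp
  have i1 : Integrable fun x => σ x * (η x * fderiv ℝ θ x v) :=
    hL.integrable_mul_of_hasCompactSupport (hη.1.continuous.mul hcθ) hη.2.mul_right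
  have i2 : Integrable fun x => σ x * (θ x * fderiv ℝ η x v) :=
    hL.integrable_mul_of_hasCompactSupport (hθ.1.continuous.mul hcη) hθ.2.mul_right
  have i3 : Integrable fun x => inner ℝ (G x) v * (η x * θ x) := by
    have : LocallyIntegrable fun x => inner ℝ (G x) v := by
      intro x
      obtain ⟨u, hu, hi⟩ := h2.locallyIntegrable x
      exact ⟨u, hu, hi.inner_const v⟩
    exact this.integrable_mul_of_hasCompactSupport (hη.1.continuous.mul hθ.1.continuous)
      hη.2.mul_right
  have e1 : ∫ x, η x * σ x * fderiv ℝ θ x v = ∫ x, σ x * (η x * fderiv ℝ θ x v) :=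
    integral_congr_ae (Eventually.of_forall fun x => by ring)
  have e2 : ∫ x, inner ℝ (η x • G x + σ x • gradient η x) v * θ x =
      (∫ x, inner ℝ (G x) v * (η x * θ x)) + ∫ x, σ x * (θ x * fderiv ℝ η x v) := by
    rw [← integral_add i3 i2]
    refine integral_congr_ae (Eventually.of_forall fun x => ?_)
    have := real_inner_gradient_right η x v
    rw [real_inner_comm] at this
    simp only [inner_add_left, inner_smul_left, this, RCLike.conj_to_real]
    ring
  simp only [hd, mul_add] at key
  rw [integral_add i1 i2] at key
  rw [e1, e2]
  linarith

/-- A divergence free field may be tested with compactly supported `H¹` functions. -/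
theorem DivEqZero.mulDivNonneg {φ σ : RN N → ℝ} {G : RN N → RN N} (hφ : MemLpLoc φ ⊤)
    (hσ : IsH1Loc σ G) (h : DivEqZero φ G) : MulDivNonneg φ σ G := by
  intro η hη _
  set W : RN N → RN N := fun x => η x • G x + σ x • gradient η x with hWdef
  set w : RN N → ℝ := fun x => η x * σ x with hwdef
  have hw := hσ.isWeakGradient_mul hη
  obtain ⟨h1, h2, -⟩ := hσ
  obtain ⟨R, hR⟩ := hη.2.isCompact.isBounded.subset_closedBall (0 : RN N)
  have hη0 : ∀ x, x ∉ tsupport η → η x = 0 := fun x => image_eq_zero_of_notMem_tsupport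
  have hW0 : ∀ x, x ∉ tsupport η → W x = 0 := fun x hx => by
    simp [hWdef, hη0 x hx, gradient_eq_zero_of_notMem_tsupport hx]
  have hWL : MemLp W 2 := by
    have : MemLpLoc W 2 := fun K hK =>
      (hη.1.continuous.smul_memLpLoc h2 K hK).add (h1.smul_continuous hη.continuous_gradient K hK)
    exact this.memLp_of_eq_zero hη.2.isCompact hW0
  have hwL : LocallyIntegrable w := (hη.1.continuous.smul_memLpLoc h1).locallyIntegrable
  have hws : HasCompactSupport w := hη.2.mul_right
  -- The extra `1` leaves room for mollifiers of radius below `1`. Cutting the flux off outside `B`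
  -- puts it in `L²` without changing any of the pairings below.
  set B : Set (RN N) := Metric.closedBall 0 (R + 1) with hB
  set A : RN N → RN N := B.indicator fun x => φ x ^ 2 • G x with hA
  have hAL : MemLp A 2 := (memLp_indicator_iff_restrict Metric.isClosed_closedBall.measurableSet).2
    (hφ.top_sq_smul h2 B (isCompact_closedBall _ _))
  have hAeq : ∀ V : RN N → RN N, (∀ x ∉ B, V x = 0) →
      ∀ x, φ x ^ 2 * inner ℝ (G x) (V x) = inner ℝ (A x) (V x) := by
    intro V hV x
    by_cases hx : x ∈ B
    · rw [hA, indicator_of_mem hx, inner_smul_left]; rfl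
    · rw [hV x hx, inner_zero_right, inner_zero_right, mul_zero]
  -- Testing with `w ⋆ ρ` says `∫ ρ F = 0`. As `F` is continuous and `ρ` concentrates at the origin,
  -- `F 0 = 0`, which is the claim. The composition with negation below undoes the reflection in the
  -- convolution evaluated at `0`.
  set F : RN N → ℝ := fun t => ∫ x, inner ℝ (A x) (W (x - t)) with hF
  have hFc : Continuous F := continuous_integral_inner_sub hAL hWL
  obtain ⟨b, hb, -⟩ := exists_bump_seq N
  have hlim := ContDiffBump.convolution_tendsto_right_of_continuous (μ := volume) hb
    (hFc.comp continuous_neg) 0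
  have hzero : ∀ᶠ n in atTop,
      ((b n).normed volume ⋆[lsmul ℝ ℝ, volume] (F ∘ Neg.neg)) 0 = 0 := by
    have hev : ∀ᶠ n in atTop, (b n).rOut < 1 := hb.eventually (gt_mem_nhds one_pos)
    filter_upwards [hev] with n hn
    set ρ := (b n).normed volume with hρdef
    have hρ : IsTestFun ρ := (b n).isTestFun_normed
    have hsupp : tsupport (w ⋆[lsmul ℝ ℝ, volume] ρ) ⊆ B := by
      refine closure_minimal ?_ Metric.isClosed_closedBall
      refine (support_convolution_subset (lsmul ℝ ℝ)).trans ?_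
      rintro _ ⟨x, hx, y, hy, rfl⟩
      have hx' : ‖x‖ ≤ R := by
        have hxη : x ∈ Function.support η := fun h0 => hx (by simp [hwdef, h0])
        simpa using hR (subset_tsupport _ hxη)
      have hy' : ‖y‖ < 1 := by
        rw [hρdef, (b n).support_normed_eq] at hy
        exact (mem_ball_zero_iff.1 hy).trans hn
      rw [hB, mem_closedBall_zero_iff]
      exact (norm_add_le _ _).trans (by linarith)
    have h0 := h _ (IsTestFun.convolution hwL hws hρ)
    have hcalc : ∀ x, φ x ^ 2 * inner ℝ (G x) (gradient (w ⋆[lsmul ℝ ℝ, volume] ρ) x) =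
        ∫ t, ρ t * inner ℝ (A x) (W (x - t)) := by
      intro x
      rw [hAeq _ (fun x hx => gradient_eq_zero_of_notMem_tsupport fun h => hx (hsupp h)),
        real_inner_gradient_right, hw.fderiv_convolution_apply hwL hρ,
        ← integral_sub_left_eq_self _ volume x]
      refine integral_congr_ae (Eventually.of_forall fun t => ?_)
      simp only [sub_sub_cancel]
      rw [real_inner_comm, mul_comm]
    simp only [hcalc] at h0
    rw [integral_integral_swap (integrable_smul_inner_sub hAL hWL hρ)] at h0
    rw [convolution_def]
    simpa [hF, integral_const_mul] using h0
  have hF0 : F 0 = 0 := by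
    have := tendsto_nhds_unique (hlim.congr' hzero) tendsto_const_nhds
    simpa using this
  have hWB : ∀ x ∉ B, W x = 0 := fun x hx => hW0 x fun hx' => hx
    (Metric.closedBall_subset_closedBall (by linarith) (hR hx'))
  have : ∫ x, φ x ^ 2 * inner ℝ (G x) (W x) = 0 := by
    simp only [hAeq W hWB]
    simpa [hF] using hF0
  rw [this, neg_zero]

/-! ### Caccioppoli inequality and the Liouville property -/

open scoped Manifold Topology

theorem MeasureTheory.MemLp.integrable_inner_real {A W : RN N → RN N} (hA : MemLp A 2)
    (hW : MemLp W 2) : Integrable fun x => inner ℝ (A x) (W x) :=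
  (hA.norm.integrable_mul hW.norm).mono' (hA.1.inner hW.1)
    (Eventually.of_forall fun x => norm_inner_le_norm (𝕜 := ℝ) (A x) (W x))

/-- Caccioppoli inequality. -/
theorem MulDivNonneg.caccioppoli {φ σ : RN N → ℝ} {G : RN N → RN N} (hφ : MemLpLoc φ ⊤)
    (hσ : IsH1Loc σ G) (h : MulDivNonneg φ σ G) {ζ : RN N → ℝ} (hζ : IsTestFun ζ) :
    ∫ x, φ x ^ 2 * ζ x ^ 2 * ‖G x‖ ^ 2 ≤ 4 * ∫ x, (φ x * σ x) ^ 2 * ‖gradient ζ x‖ ^ 2 := by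
  obtain ⟨h1, h2, -⟩ := hσ
  have hη : IsTestFun fun x => ζ x * ζ x := IsTestFun.mul hζ.1 hζ
  have hmain := h _ hη fun x => mul_self_nonneg _
  have hgrad : ∀ x, gradient (fun x => ζ x * ζ x) x = (2 * ζ x) • gradient ζ x := by
    intro x
    have hd : DifferentiableAt ℝ ζ x := hζ.1.differentiable (by simp) x
    rw [gradient, gradient, fderiv_fun_mul hd hd, ← add_smul, ← two_mul, map_smul]
  have hφG : MemLpLoc (fun x => ‖φ x • G x‖) 2 := fun K hK => (hφ.top_smul h2 K hK).norm
  have hφσ : MemLpLoc (fun x => φ x * σ x) 2 := hφ.top_smul h1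
  have iA : Integrable fun x => φ x ^ 2 * ζ x ^ 2 * ‖G x‖ ^ 2 := by
    refine ((hφG.locallyIntegrable_mul hφG).integrable_mul_of_hasCompactSupport
      hη.1.continuous hη.2).congr (Eventually.of_forall fun x => ?_)
    simp only [norm_smul, Real.norm_eq_abs]
    rw [← sq_abs (φ x)]; ring
  have iB : Integrable fun x => (φ x * σ x) ^ 2 * ‖gradient ζ x‖ ^ 2 := by
    have hc : HasCompactSupport fun x => ‖gradient ζ x‖ ^ 2 :=
      hζ.2.mono' fun x hx => by
        by_contra h0
        exact hx (by simp [gradient_eq_zero_of_notMem_tsupport h0])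
    refine ((hφσ.locallyIntegrable_mul hφσ).integrable_mul_of_hasCompactSupport
      (hζ.continuous_gradient.norm.pow 2) hc).congr (Eventually.of_forall fun x => ?_)
    simp only [Pi.pow_apply]
    ring
  -- Young's inequality `2ab ≤ a²/2 + 2b²` with `a = |φζ||G|` and `b = |φσ||∇ζ|` absorbs half of the
  -- energy; the ratio of `2` to `1/2` is the constant `4`.
  have hpt : ∀ x, -(φ x ^ 2 * inner ℝ (G x)
      ((ζ x * ζ x) • G x + σ x • gradient (fun x => ζ x * ζ x) x)) ≤
      2 * ((φ x * σ x) ^ 2 * ‖gradient ζ x‖ ^ 2) - 1 / 2 * (φ x ^ 2 * ζ x ^ 2 * ‖G x‖ ^ 2) := by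
    intro x
    rw [hgrad, inner_add_right, inner_smul_right, inner_smul_right, inner_smul_right,
      real_inner_self_eq_norm_sq]
    have hcs := abs_real_inner_le_norm (G x) (gradient ζ x)
    set c := inner ℝ (G x) (gradient ζ x)
    set g := ‖G x‖
    set d := ‖gradient ζ x‖
    have hsq : c ^ 2 ≤ g ^ 2 * d ^ 2 := by
      rw [← mul_pow, ← sq_abs c]
      exact pow_le_pow_left₀ (abs_nonneg _) hcs 2
    have h3 : -(2 * (φ x * ζ x) * (φ x * σ x) * c) ≤
        1 / 2 * ((φ x * ζ x) ^ 2 * g ^ 2) + 2 * ((φ x * σ x) ^ 2 * d ^ 2) := by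
      have hb : |(φ x * ζ x) * (φ x * σ x) * c| ≤
          (|φ x * ζ x| * g) * (|φ x * σ x| * d) := by
        rw [abs_mul, abs_mul]
        calc |φ x * ζ x| * |φ x * σ x| * |c| ≤ |φ x * ζ x| * |φ x * σ x| * (g * d) := by gcongr
          _ = _ := by ring
      have hy := neg_abs_le ((φ x * ζ x) * (φ x * σ x) * c)
      have e1 : (φ x * ζ x) ^ 2 = |φ x * ζ x| ^ 2 := (sq_abs _).symm
      have e2 : (φ x * σ x) ^ 2 = |φ x * σ x| ^ 2 := (sq_abs _).symm
      rw [e1, e2]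
      nlinarith [sq_nonneg (|φ x * ζ x| * g - 2 * (|φ x * σ x| * d))]
    nlinarith [h3]
  have hle : 0 ≤ ∫ x, (2 * ((φ x * σ x) ^ 2 * ‖gradient ζ x‖ ^ 2) -
      1 / 2 * (φ x ^ 2 * ζ x ^ 2 * ‖G x‖ ^ 2)) := by
    -- Monotonicity of the integral needs this integrability, as a Bochner integral defaults to `0`
    -- otherwise. The second branch proves it: the integrand is a pairing of two `L²` fields.
    by_cases hi : Integrable fun x => -(φ x ^ 2 * inner ℝ (G x)
      ((ζ x * ζ x) • G x + σ x • gradient (fun x => ζ x * ζ x) x))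
    · refine hmain.trans ?_
      rw [← integral_neg]
      exact integral_mono hi ((iB.const_mul 2).sub (iA.const_mul _)) hpt
    · exfalso
      apply hi
      have hW : MemLpLoc (fun x => (ζ x * ζ x) • G x +
          σ x • gradient (fun x => ζ x * ζ x) x) 2 := fun K hK =>
        (hη.1.continuous.smul_memLpLoc h2 K hK).add
          (h1.smul_continuous hη.continuous_gradient K hK)
      have hW0 := hW.memLp_of_eq_zero hη.2.isCompact fun x hx => by
        rw [gradient_eq_zero_of_notMem_tsupport hx, show ζ x * ζ x = 0 from
          image_eq_zero_of_notMem_tsupport (f := fun x => ζ x * ζ x) hx]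
        simp
      have hA : MemLp ((tsupport fun x => ζ x * ζ x).indicator fun x => φ x ^ 2 • G x) 2 :=
        (memLp_indicator_iff_restrict hη.2.isCompact.measurableSet).2
          (hφ.top_sq_smul h2 _ hη.2.isCompact)
      refine (hA.integrable_inner_real hW0).neg.congr (Eventually.of_forall fun x => ?_)
      by_cases hx : x ∈ tsupport fun x => ζ x * ζ x
      · simp only [Pi.neg_apply, indicator_of_mem hx, inner_smul_left]; rfl
      · have : ζ x * ζ x = 0 := image_eq_zero_of_notMem_tsupport (f := fun x => ζ x * ζ x) hx
        simp [indicator_of_notMem hx, gradient_eq_zero_of_notMem_tsupport hx, this]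
  rw [integral_sub (iB.const_mul 2) (iA.const_mul _), integral_const_mul,
    integral_const_mul] at hle
  linarith

/-- A smooth function between `1 / (2 ψ)` and `1 / ψ`. -/
theorem exists_contDiff_between_inv {ψ : ℝ → ℝ} (hψ : Continuous ψ) (hψ0 : ∀ t, 0 < ψ t) :
    ∃ q : ℝ → ℝ, ContDiff ℝ ∞ q ∧ ∀ t, 1 / (2 * ψ t) < q t ∧ q t < 1 / ψ t := by
  have hc1 : Continuous fun t => 1 / (2 * ψ t) :=
    continuous_const.div (continuous_const.mul hψ) fun t => (mul_pos two_pos (hψ0 t)).ne'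
  have hc2 : Continuous fun t => 1 / ψ t := continuous_const.div hψ fun t => (hψ0 t).ne'
  have hlt : ∀ t, 1 / (2 * ψ t) < 1 / ψ t := fun t =>
    one_div_lt_one_div_of_lt (hψ0 t) (by linarith [hψ0 t])
  -- Local constants satisfy the strict inequalities, and a partition of unity glues them because
  -- intervals are convex.
  obtain ⟨g, hg⟩ := exists_contMDiffMap_forall_mem_convex_of_local_const 𝓘(ℝ, ℝ) (n := (⊤ : ℕ∞))
    (t := fun t => Ioo (1 / (2 * ψ t)) (1 / ψ t)) (fun t => convex_Ioo _ _) fun x => by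
      obtain ⟨c, hc, hc'⟩ := exists_between (hlt x)
      exact ⟨c, (hc1.continuousAt.eventually_lt_const hc).and
        (hc2.continuousAt.eventually_const_lt hc')⟩
  exact ⟨g, g.contMDiff.contDiff, hg⟩

/-- A smooth cutoff on the line, equal to `1` before `1 / 2` and to `0` after `1`. -/
theorem exists_smooth_step : ∃ (θ : ℝ → ℝ) (C : ℝ), ContDiff ℝ ∞ θ ∧ (∀ s ≤ 1 / 2, θ s = 1) ∧
    (∀ s, 1 ≤ s → θ s = 0) ∧ 0 ≤ C ∧ (∀ s, |deriv θ s| ≤ C) ∧ ∀ s, 1 ≤ s → deriv θ s = 0 := by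
  set θ : ℝ → ℝ := fun s => Real.smoothTransition (2 - 2 * s) with hθ
  have hd : ContDiff ℝ ∞ θ :=
    Real.smoothTransition.contDiff.comp (contDiff_const.sub (contDiff_const.mul contDiff_id))
  have h1 : ∀ s ≤ 1 / 2, θ s = 1 := fun s hs =>
    Real.smoothTransition.one_of_one_le (by linarith)
  have h0 : ∀ s, 1 ≤ s → θ s = 0 := fun s hs =>
    Real.smoothTransition.zero_of_nonpos (by linarith)
  have hdc : Continuous (deriv θ) := hd.continuous_deriv (by simp)
  have hd1 : ∀ s < 1 / 2, deriv θ s = 0 := by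
    intro s hs
    have : θ =ᶠ[𝓝 s] fun _ => 1 := by
      filter_upwards [Iio_mem_nhds hs] with t ht using h1 t (le_of_lt ht)
    rw [this.deriv_eq, deriv_const]
  have hd0' : ∀ s ∈ Ioi (1 : ℝ), deriv θ s = 0 := by
    intro s hs
    have : θ =ᶠ[𝓝 s] fun _ => 0 := by
      filter_upwards [Ioi_mem_nhds hs] with t ht using h0 t (le_of_lt ht)
    rw [this.deriv_eq, deriv_const]
  -- The endpoint `s = 1` follows by continuity. It matters because the cutoff gradient must vanish
  -- on all of `{r ≥ T}`, the mass being estimated on the open set `{r < T}`.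
  have hd0 : ∀ s, 1 ≤ s → deriv θ s = 0 := by
    intro s hs
    have hcl : IsClosed {s | deriv θ s = 0} := isClosed_eq hdc continuous_const
    have : closure (Ioi (1 : ℝ)) ⊆ {s | deriv θ s = 0} := closure_minimal hd0' hcl
    rw [closure_Ioi] at this
    exact this hs
  obtain ⟨C, hC⟩ := isCompact_Icc.exists_bound_of_continuousOn
    (hdc.continuousOn (s := Icc (1 / 2 : ℝ) 1))
  refine ⟨θ, max C 0, hd, h1, h0, le_max_right _ _, fun s => ?_, hd0⟩
  by_cases hs : s ∈ Icc (1 / 2 : ℝ) 1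
  · exact (hC s hs).trans (le_max_left _ _)
  · rcases not_and_or.1 hs with h | h
    · rw [hd1 s (not_le.1 h), abs_zero]; exact le_max_right _ _
    · rw [hd0 s (not_le.1 h).le, abs_zero]; exact le_max_right _ _

/-- The regularised radius `√(1 + |x|²)`. -/
noncomputable def smoothRadius (x : RN N) : ℝ := √(1 + ‖x‖ ^ 2)

theorem contDiff_smoothRadius : ContDiff ℝ ∞ (smoothRadius (N := N)) :=
  (contDiff_const.add (contDiff_norm_sq ℝ)).sqrt fun x => by positivity

/-- Passing from `|x|` to `√(1 + |x|²)` removes the singularity at the origin at no cost: sublevel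
sets shrink, so the growth bound still covers them, and the gradient stays at most `1`. -/
theorem norm_lt_smoothRadius (x : RN N) : ‖x‖ < smoothRadius x :=
  Real.lt_sqrt_of_sq_lt (by linarith)

theorem norm_fderiv_smoothRadius_le (x : RN N) : ‖fderiv ℝ smoothRadius x‖ ≤ 1 := by
  have h1 : HasFDerivAt (fun x : RN N => 1 + ‖x‖ ^ 2) (2 • innerSL ℝ x) x :=
    ((hasStrictFDerivAt_norm_sq x).hasFDerivAt).const_add 1
  have h2 : (1 + ‖x‖ ^ 2 : ℝ) ≠ 0 := by positivity
  have h3 := h1.sqrt h2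
  rw [show smoothRadius = fun x : RN N => √(1 + ‖x‖ ^ 2) from rfl, h3.fderiv]
  have h4 : 0 < √(1 + ‖x‖ ^ 2) := by positivity
  have h5 : ‖x‖ ≤ √(1 + ‖x‖ ^ 2) := (norm_lt_smoothRadius x).le
  rw [norm_smul, ← Nat.cast_smul_eq_nsmul ℝ, norm_smul, innerSL_apply_norm, Real.norm_eq_abs,
    abs_of_pos (by positivity)]
  simp only [Nat.cast_ofNat, Real.norm_ofNat]
  rw [show 1 / (2 * √(1 + ‖x‖ ^ 2)) * (2 * ‖x‖) = ‖x‖ / √(1 + ‖x‖ ^ 2) by field_simp]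
  exact (div_le_one h4).2 h5

theorem norm_gradient_eq (f : RN N → ℝ) (x : RN N) : ‖gradient f x‖ = ‖fderiv ℝ f x‖ := by
  rw [gradient, LinearIsometryEquiv.norm_map]

theorem norm_gradient_comp_smoothRadius_le {h : ℝ → ℝ} {h' : ℝ} (x : RN N)
    (hh : HasDerivAt h h' (smoothRadius x)) :
    ‖gradient (fun y => h (smoothRadius y)) x‖ ≤ |h'| := by
  have := hh.comp_hasFDerivAt x
    ((contDiff_smoothRadius (N := N)).differentiable (by simp) x).hasFDerivAt
  rw [norm_gradient_eq, show (fun y => h (smoothRadius y)) = h ∘ smoothRadius from rfl,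
    this.fderiv, norm_smul, Real.norm_eq_abs]
  exact mul_le_of_le_one_right (abs_nonneg _) (norm_fderiv_smoothRadius_le x)


/-- The primitive of a smooth function is smooth. -/
theorem contDiff_integral_of_contDiff {q : ℝ → ℝ} (hq : ContDiff ℝ ∞ q) :
    ContDiff ℝ ∞ fun r => ∫ t in (0 : ℝ)..r, q t := by
  have hd : ∀ r, HasDerivAt (fun r => ∫ t in (0 : ℝ)..r, q t) (q r) r := fun r =>
    intervalIntegral.integral_hasDerivAt_right (hq.continuous.intervalIntegrable _ _)
      hq.continuous.aestronglyMeasurable.stronglyMeasurableAtFilter hq.continuous.continuousAt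
  rw [contDiff_infty_iff_deriv]
  exact ⟨fun r => (hd r).differentiableAt, by rwa [funext fun r => (hd r).deriv]⟩

/-- The growth bound controls the mass of `(φ σ)²` in sublevel sets of the regularised radius. -/
theorem GrowthBound.withDensity_le {Ψ : ℝ → ℝ} {φ σ : RN N → ℝ}
    (hφσ : MemLpLoc (fun x => φ x * σ x) 2) (h : GrowthBound Ψ φ σ) {t : ℝ} (ht : 1 ≤ t) :
    (volume.withDensity fun x => ENNReal.ofReal ((φ x * σ x) ^ 2)) {x | smoothRadius x < t} ≤
      ENNReal.ofReal (Ψ t) := by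
  have hm : MeasurableSet {x : RN N | smoothRadius x < t} :=
    measurableSet_lt contDiff_smoothRadius.continuous.measurable measurable_const
  have hsub : {x : RN N | smoothRadius x < t} ⊆ Metric.ball 0 t := fun x hx =>
    mem_ball_zero_iff.2 ((norm_lt_smoothRadius x).trans hx)
  rw [withDensity_apply _ hm]
  refine (lintegral_mono_set hsub).trans ?_
  rw [← ofReal_integral_eq_lintegral_ofReal]
  · exact ENNReal.ofReal_le_ofReal (h t ht)
  · refine IntegrableOn.mono_set ?_ Metric.ball_subset_closedBall
    exact (hφσ _ (isCompact_closedBall 0 t)).integrable_sq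
  · exact Eventually.of_forall fun x => sq_nonneg _

/-- The weighted Dirichlet energy against a logarithmic type cutoff. -/
theorem MulDivNonneg.integral_cutoff_le {Ψ ψ q θ : ℝ → ℝ} {φ σ : RN N → ℝ} {G : RN N → RN N}
    {R₀ C T : ℝ} (hφ : MemLpLoc φ ⊤) (hσ : IsH1Loc σ G) (h : MulDivNonneg φ σ G)
    (hg : GrowthBound Ψ φ σ) (hψ : Continuous ψ) (hψ0 : ∀ t, 0 < ψ t) (hmono : Monotone ψ)
    (hconst : ∀ t ≤ R₀, ψ t = ψ R₀) (hR₀ : 1 ≤ R₀) (hΨ0 : 0 ≤ Ψ R₀)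
    (hint : ∀ t, R₀ ≤ t → Ψ R₀ + ∫ s in R₀..t, ψ s = Ψ t) (hq : ContDiff ℝ ∞ q)
    (hq1 : ∀ t, 1 / (2 * ψ t) < q t) (hq2 : ∀ t, q t < 1 / ψ t) (hθ : ContDiff ℝ ∞ θ)
    (hθ0 : ∀ s, 1 ≤ s → θ s = 0) (hC : 0 ≤ C) (hθC : ∀ s, |deriv θ s| ≤ C)
    (hθ' : ∀ s, 1 ≤ s → deriv θ s = 0) (hT : R₀ < T) :
    IsTestFun (fun x : RN N =>
      θ ((∫ t in (0 : ℝ)..smoothRadius x, q t) / ∫ t in (0 : ℝ)..T, q t)) ∧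
    ∫ x, φ x ^ 2 * θ ((∫ t in (0 : ℝ)..smoothRadius x, q t) / ∫ t in (0 : ℝ)..T, q t) ^ 2 *
      ‖G x‖ ^ 2 ≤ 4 * ((C / ∫ t in (0 : ℝ)..T, q t) ^ 2 *
        (Ψ R₀ / ψ R₀ ^ 2 + 2 * ∫ t in (0 : ℝ)..T, q t)) := by
  set Q : ℝ → ℝ := fun r => ∫ t in (0 : ℝ)..r, q t with hQ
  have hq0 : ∀ t, 0 < q t := fun t =>
    lt_trans (one_div_pos.2 (mul_pos two_pos (hψ0 t))) (hq1 t)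
  have hQd : ∀ r, HasDerivAt Q (q r) r := fun r =>
    intervalIntegral.integral_hasDerivAt_right (hq.continuous.intervalIntegrable _ _)
      hq.continuous.aestronglyMeasurable.stronglyMeasurableAtFilter hq.continuous.continuousAt
  have hQmono : StrictMono Q := strictMono_of_hasDerivAt_pos hQd hq0
  have hQ0 : Q 0 = 0 := intervalIntegral.integral_same
  have hQT : 0 < Q T := hQ0 ▸ hQmono (by linarith)
  set ζ : RN N → ℝ := fun x => θ (Q (smoothRadius x) / Q T) with hζdef
  have hge : ∀ x : RN N, T ≤ smoothRadius x → 1 ≤ Q (smoothRadius x) / Q T := fun x hx =>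
    (one_le_div hQT).2 (hQmono.monotone hx)
  have hζ : IsTestFun ζ := by
    refine ⟨hθ.comp (((contDiff_integral_of_contDiff hq).comp contDiff_smoothRadius).div_const _),
      HasCompactSupport.intro (isCompact_closedBall 0 T) fun x hx => hθ0 _ (hge x ?_)⟩
    rw [mem_closedBall_zero_iff, not_le] at hx
    exact (hx.trans (norm_lt_smoothRadius x)).le
  refine ⟨hζ, (h.caccioppoli hφ hσ hζ).trans (mul_le_mul_of_nonneg_left ?_ zero_le_four)⟩
  -- The chain rule gives `|∇ζ| ≤ |θ'| q(r) / Q(T)`, and `q < 1/ψ`; beyond `T` the factor `θ'`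
  -- vanishes.
  have hgrad : ∀ x : RN N, ‖gradient ζ x‖ ^ 2 ≤
      {x | smoothRadius x < T}.indicator
        (fun x => (C / Q T) ^ 2 * (1 / ψ (smoothRadius x) ^ 2)) x := by
    intro x
    have hd : HasDerivAt (fun r => θ (Q r / Q T))
        (deriv θ (Q (smoothRadius x) / Q T) * (q (smoothRadius x) / Q T)) (smoothRadius x) :=
      HasDerivAt.comp (smoothRadius x) (hθ.differentiable (by simp) _).hasDerivAt
        ((hQd _).div_const _)
    have hle := norm_gradient_comp_smoothRadius_le x hd
    by_cases hx : smoothRadius x < T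
    · rw [indicator_of_mem (show x ∈ {x | smoothRadius x < T} from hx)]
      have h1 : ‖gradient ζ x‖ ≤ C / Q T * (1 / ψ (smoothRadius x)) := by
        refine hle.trans ?_
        rw [abs_mul, abs_of_pos (div_pos (hq0 _) hQT)]
        calc _ ≤ C * ((1 / ψ (smoothRadius x)) / Q T) := by
              have := hq0 (smoothRadius x)
              gcongr
              · exact hθC _
              · exact (hq2 _).le
          _ = _ := by ring
      calc ‖gradient ζ x‖ ^ 2 ≤ (C / Q T * (1 / ψ (smoothRadius x))) ^ 2 :=
            pow_le_pow_left₀ (norm_nonneg _) h1 2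
        _ = _ := by ring
    · rw [indicator_of_notMem (show x ∉ {x | smoothRadius x < T} from hx)]
      rw [hθ' _ (hge x (not_lt.1 hx)), zero_mul, abs_zero] at hle
      have : ‖gradient ζ x‖ = 0 := le_antisymm hle (norm_nonneg _)
      simp [this]
  have hφσ : MemLpLoc (fun x => φ x * σ x) 2 := hφ.top_smul hσ.1
  have hms : AEStronglyMeasurable (fun x => (φ x * σ x) ^ 2) volume :=
    hφσ.aestronglyMeasurable.pow 2
  set μ := (volume : Measure (RN N)).withDensity fun x => ENNReal.ofReal ((φ x * σ x) ^ 2) with hμ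
  have hrm : Measurable (smoothRadius (N := N)) := contDiff_smoothRadius.continuous.measurable
  have hset : MeasurableSet {x : RN N | smoothRadius x < T} := measurableSet_lt hrm measurable_const
  have hlayer := lintegral_inv_sq_le μ hrm hψ hψ0 hmono hconst hT hΨ0 (fun t ht => by
    rw [hint t ht]
    exact hg.withDensity_le hφσ (hR₀.trans ht))
  -- The factor `2` comes from `1/ψ < 2q`.
  have hI : Ψ R₀ / ψ R₀ ^ 2 + ∫ s in R₀..T, 1 / ψ s ≤ Ψ R₀ / ψ R₀ ^ 2 + 2 * Q T := by
    have hc2 : Continuous fun t => 1 / ψ t := continuous_const.div hψ fun t => (hψ0 t).ne'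
    have h1 : ∫ s in R₀..T, 1 / ψ s ≤ ∫ s in R₀..T, 2 * q s := by
      refine intervalIntegral.integral_mono_on hT.le (hc2.intervalIntegrable _ _)
        ((continuous_const.mul hq.continuous).intervalIntegrable _ _) fun t _ => ?_
      have h2 := hq1 t
      rw [show 1 / (2 * ψ t) = 1 / ψ t / 2 by ring] at h2
      linarith
    have h2 : ∫ s in R₀..T, q s = Q T - Q R₀ :=
      intervalIntegral.integral_eq_sub_of_hasDerivAt (fun t _ => hQd t)
        (hq.continuous.intervalIntegrable _ _)
    have h3 : 0 ≤ Q R₀ := hQ0 ▸ hQmono.monotone (by linarith)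
    rw [intervalIntegral.integral_const_mul, h2] at h1
    linarith
  have hw : Measurable fun x : RN N => ENNReal.ofReal (1 / ψ (smoothRadius x) ^ 2) :=
    (measurable_const.div ((hψ.measurable.comp hrm).pow_const 2)).ennreal_ofReal
  have hmain : ∫⁻ x, ENNReal.ofReal ((φ x * σ x) ^ 2 * ‖gradient ζ x‖ ^ 2) ≤
      ENNReal.ofReal ((C / Q T) ^ 2 * (Ψ R₀ / ψ R₀ ^ 2 + 2 * Q T)) := by
    calc ∫⁻ x, ENNReal.ofReal ((φ x * σ x) ^ 2 * ‖gradient ζ x‖ ^ 2)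
        ≤ ∫⁻ x, ENNReal.ofReal ((φ x * σ x) ^ 2) * {x | smoothRadius x < T}.indicator
            (fun x => ENNReal.ofReal ((C / Q T) ^ 2) *
              ENNReal.ofReal (1 / ψ (smoothRadius x) ^ 2)) x := by
          refine lintegral_mono fun x => ?_
          rw [ENNReal.ofReal_mul (sq_nonneg _)]
          refine mul_le_mul_right ?_ _
          refine (ENNReal.ofReal_le_ofReal (hgrad x)).trans (le_of_eq ?_)
          by_cases hx : x ∈ {x : RN N | smoothRadius x < T}
          · rw [indicator_of_mem hx, indicator_of_mem hx, ENNReal.ofReal_mul (sq_nonneg _)]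
          · rw [indicator_of_notMem hx, indicator_of_notMem hx, ENNReal.ofReal_zero]
      _ = ∫⁻ x in {x | smoothRadius x < T}, ENNReal.ofReal ((C / Q T) ^ 2) *
            ENNReal.ofReal (1 / ψ (smoothRadius x) ^ 2) ∂μ := by
          rw [← lintegral_indicator hset, hμ, lintegral_withDensity_eq_lintegral_mul₀
            hms.aemeasurable.ennreal_ofReal ((hw.const_mul _).indicator hset).aemeasurable]
          rfl
      _ = ENNReal.ofReal ((C / Q T) ^ 2) * ∫⁻ x in {x | smoothRadius x < T},
            ENNReal.ofReal (1 / ψ (smoothRadius x) ^ 2) ∂μ := lintegral_const_mul _ hw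
      _ ≤ ENNReal.ofReal ((C / Q T) ^ 2) *
            ENNReal.ofReal (Ψ R₀ / ψ R₀ ^ 2 + 2 * Q T) :=
          mul_le_mul_right (hlayer.trans (ENNReal.ofReal_le_ofReal hI)) _
      _ = _ := (ENNReal.ofReal_mul (sq_nonneg _)).symm
  rw [integral_eq_lintegral_of_nonneg_ae
    (Eventually.of_forall fun x => mul_nonneg (sq_nonneg _) (sq_nonneg _))
    (hms.mul (hζ.continuous_gradient.norm.pow 2).aestronglyMeasurable)]
  refine ENNReal.toReal_le_of_le_ofReal ?_ hmain
  have := hψ0 R₀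
  positivity

/-- A monotone primitive that does not tend to infinity converges, which makes `q` integrable on
`(R₀, ∞)`. Then `1/p < 2q` is integrable there, and on `[1, R₀]` it is continuous, so the total
could not be infinite. -/
theorem tendsto_integral_atTop_of_lintegral_inv_eq_top {p ψ q : ℝ → ℝ} {R₀ : ℝ} (hR₀ : 1 ≤ R₀)
    (hp : ContinuousOn p (Ici 1)) (hp0 : ∀ t, 1 ≤ t → 0 < p t) (hpψ : ∀ t, R₀ ≤ t → ψ t = p t)
    (hq : Continuous q) (hq0 : ∀ t, 0 < q t) (hq1 : ∀ t, 1 / (2 * ψ t) < q t)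
    (htop : ∫⁻ r in Ici (1 : ℝ), ENNReal.ofReal (1 / p r) = ⊤) :
    Tendsto (fun r => ∫ t in (0 : ℝ)..r, q t) atTop atTop := by
  have hQd : ∀ r, HasDerivAt (fun r => ∫ t in (0 : ℝ)..r, q t) (q r) r := fun r =>
    intervalIntegral.integral_hasDerivAt_right (hq.intervalIntegrable _ _)
      hq.aestronglyMeasurable.stronglyMeasurableAtFilter hq.continuousAt
  rcases tendsto_atTop_of_monotone (strictMono_of_hasDerivAt_pos hQd hq0).monotone with h | ⟨l, hl⟩
  · exact h
  exfalso
  have hqi : IntegrableOn q (Ioi R₀) :=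
    integrableOn_Ioi_deriv_of_nonneg' (fun x _ => hQd x) (fun x _ => (hq0 x).le) hl
  have h1 : ∫⁻ r in Icc 1 R₀, ENNReal.ofReal (1 / p r) < ⊤ := by
    have : IntegrableOn (fun r => 1 / p r) (Icc 1 R₀) :=
      ((continuousOn_const.div hp fun t ht => (hp0 t ht).ne').mono
        Icc_subset_Ici_self).integrableOn_Icc
    exact this.lintegral_lt_top
  have h2 : ∫⁻ r in Ioi R₀, ENNReal.ofReal (1 / p r) < ⊤ := by
    refine lt_of_le_of_lt ?_ (hqi.const_mul 2).lintegral_lt_top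
    refine setLIntegral_mono' measurableSet_Ioi fun t ht => ENNReal.ofReal_le_ofReal ?_
    have h2 := hq1 t
    rw [hpψ t (le_of_lt ht), show 1 / (2 * p t) = 1 / p t / 2 by ring] at h2
    linarith
  have h3 : Ici (1 : ℝ) = Icc 1 R₀ ∪ Ioi R₀ := (Icc_union_Ioi_eq_Ici hR₀).symm
  rw [h3] at htop
  exact ((lintegral_union_le _ _ _).trans_lt (ENNReal.add_lt_top.2 ⟨h1, h2⟩)).ne htop

theorem propertyP_of_lintegral_eq_top (N : ℕ) {Ψ : ℝ → ℝ} (hΨ : ContDiffOn ℝ 1 Ψ (Ici 1))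
    (hpos : ∀ R : ℝ, 1 ≤ R → 0 < Ψ R)
    (hderiv : ∀ R : ℝ, 1 ≤ R → 0 < derivWithin Ψ (Ici 1) R) {R₀ : ℝ} (hR₀ : 1 < R₀)
    (hconv : ConvexOn ℝ (Ici R₀) Ψ)
    (htop : ∫⁻ r in Ici (1 : ℝ), ENNReal.ofReal (1 / derivWithin Ψ (Ici 1) r) = ⊤) :
    PropertyP N Ψ := by
  intro φ σ G hφ hφ0 hσ hdiv hg
  set p := derivWithin Ψ (Ici 1) with hp
  have hpc : ContinuousOn p (Ici 1) :=
    hΨ.continuousOn_derivWithin (uniqueDiffOn_Ici 1) le_rfl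
  have hpm := monotoneOn_derivWithin_Ici_one hΨ hR₀ hconv
  -- Freezing `Ψ'` to the left of `R₀` makes it continuous, positive and monotone on the whole line;
  -- the mass below `R₀` is accounted for by `Ψ R₀`.
  set ψ : ℝ → ℝ := fun t => p (max t R₀) with hψdef
  have hψ : Continuous ψ := hpc.comp_continuous (by fun_prop) fun t =>
    hR₀.le.trans (le_max_right _ _)
  have hψ0 : ∀ t, 0 < ψ t := fun t => hderiv _ (hR₀.le.trans (le_max_right _ _))
  have hmono : Monotone ψ := fun s t hst =>
    hpm (mem_Ici.2 (le_max_right _ _)) (mem_Ici.2 (le_max_right _ _)) (max_le_max_right _ hst)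
  have hconst : ∀ t ≤ R₀, ψ t = ψ R₀ := fun t ht => by simp [hψdef, max_eq_right ht]
  have hpψ : ∀ t, R₀ ≤ t → ψ t = p t := fun t ht => by simp [hψdef, max_eq_left ht]
  have hint : ∀ t, R₀ ≤ t → Ψ R₀ + ∫ s in R₀..t, ψ s = Ψ t := by
    intro t ht
    have : ∫ s in R₀..t, ψ s = ∫ s in R₀..t, p s := intervalIntegral.integral_congr fun s hs => by
      rw [uIcc_of_le ht] at hs
      exact hpψ s hs.1
    rw [this, integral_derivWithin_Ici_one hΨ hR₀.le ht]
    ring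
  -- `1/ψ` is only continuous, whereas the cutoff must be smooth to be a test function.
  obtain ⟨q, hq, hq12⟩ := exists_contDiff_between_inv hψ hψ0
  have hq0 : ∀ t, 0 < q t := fun t =>
    lt_trans (one_div_pos.2 (mul_pos two_pos (hψ0 t))) (hq12 t).1
  obtain ⟨θ, C, hθ, hθ1, hθ0, hC, hθC, hθ'⟩ := exists_smooth_step
  have hQ := tendsto_integral_atTop_of_lintegral_inv_eq_top hR₀.le hpc hderiv hpψ hq.continuous
    hq0 (fun t => (hq12 t).1) htop
  set Q : ℝ → ℝ := fun r => ∫ t in (0 : ℝ)..r, q t with hQdef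
  have hQm : Monotone Q := by
    intro a b hab
    have := intervalIntegral.integral_interval_sub_left (a := 0)
      (hq.continuous.intervalIntegrable (μ := volume) 0 b)
      (hq.continuous.intervalIntegrable (μ := volume) 0 a)
    have h2 := intervalIntegral.integral_nonneg (μ := volume) hab fun t _ => (hq0 t).le
    simp only [hQdef]
    linarith
  have hE := fun T hT => hdiv.integral_cutoff_le hφ hσ hg hψ hψ0 hmono hconst hR₀.le
    (hpos R₀ hR₀.le).le hint hq (fun t => (hq12 t).1) (fun t => (hq12 t).2) hθ hθ0 hC hθC hθ'
    (T := T) hT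
  have hlim : Tendsto (fun T => 4 * ((C / Q T) ^ 2 * (Ψ R₀ / ψ R₀ ^ 2 + 2 * Q T))) atTop
      (𝓝 0) := by
    have hinv : Tendsto (fun T => (Q T)⁻¹) atTop (𝓝 0) := hQ.inv_tendsto_atTop
    have h1 : Tendsto (fun T => 4 * (C ^ 2 * (Ψ R₀ / ψ R₀ ^ 2 * (Q T)⁻¹ ^ 2 + 2 * (Q T)⁻¹)))
        atTop (𝓝 (4 * (C ^ 2 * (Ψ R₀ / ψ R₀ ^ 2 * 0 ^ 2 + 2 * 0)))) :=
      ((((hinv.pow 2).const_mul _).add (hinv.const_mul 2)).const_mul _).const_mul _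
    rw [show 4 * (C ^ 2 * (Ψ R₀ / ψ R₀ ^ 2 * 0 ^ 2 + 2 * 0)) = 0 by ring] at h1
    refine h1.congr' ?_
    filter_upwards [hQ.eventually_gt_atTop 0] with T hT
    field_simp
  have hφG : MemLpLoc (fun x => ‖φ x • G x‖) 2 := fun K hK => (hφ.top_smul hσ.2.1 K hK).norm
  have hLI := hφG.locallyIntegrable_mul hφG
  have heq : ∀ x, ‖φ x • G x‖ * ‖φ x • G x‖ = φ x ^ 2 * ‖G x‖ ^ 2 := fun x => by
    rw [norm_smul, Real.norm_eq_abs, ← sq_abs (φ x)]; ring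
  simp only [heq] at hLI
  have hball : ∀ n : ℕ, ∀ᵐ x ∂(volume.restrict (Metric.closedBall (0 : RN N) n)),
      φ x ^ 2 * ‖G x‖ ^ 2 = 0 := by
    intro n
    have hi : IntegrableOn (fun x => φ x ^ 2 * ‖G x‖ ^ 2) (Metric.closedBall (0 : RN N) n) :=
      hLI.integrableOn_isCompact (isCompact_closedBall _ _)
    have hnn : 0 ≤ᵐ[volume.restrict (Metric.closedBall (0 : RN N) n)]
      fun x => φ x ^ 2 * ‖G x‖ ^ 2 :=
      Eventually.of_forall fun x => mul_nonneg (sq_nonneg _) (sq_nonneg _)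
    refine (integral_eq_zero_iff_of_nonneg_ae hnn hi).1 (le_antisymm ?_ (integral_nonneg_of_ae hnn))
    refine ge_of_tendsto hlim ?_
    -- `θ = 1` up to `1/2`, so `Q T` must be at least twice the largest value of `Q` on the ball for
    -- the cutoff to equal `1` there.
    filter_upwards [eventually_gt_atTop R₀, hQ.eventually_ge_atTop (2 * Q √(1 + (n : ℝ) ^ 2)),
      hQ.eventually_gt_atTop 0] with T hT hT2 hT0
    obtain ⟨hζ, hE⟩ := hE T hT
    refine le_trans ?_ hE
    have hone : ∀ x ∈ Metric.closedBall (0 : RN N) n, θ (Q (smoothRadius x) / Q T) = 1 := by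
      intro x hx
      refine hθ1 _ ?_
      rw [div_le_div_iff₀ hT0 two_pos]
      have hxn : smoothRadius x ≤ √(1 + (n : ℝ) ^ 2) := by
        have := mem_closedBall_zero_iff.1 hx
        unfold smoothRadius
        gcongr
      linarith [hQm hxn]
    have hfull : Integrable fun x => φ x ^ 2 * θ (Q (smoothRadius x) / Q T) ^ 2 * ‖G x‖ ^ 2 := by
      refine (hLI.integrable_mul_of_hasCompactSupport (hζ.1.continuous.mul hζ.1.continuous)
        hζ.2.mul_right).congr (Eventually.of_forall fun x => ?_)
      simp only [hQdef, Pi.mul_apply]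
      ring
    calc ∫ x in Metric.closedBall (0 : RN N) n, φ x ^ 2 * ‖G x‖ ^ 2
        = ∫ x in Metric.closedBall (0 : RN N) n,
            φ x ^ 2 * θ (Q (smoothRadius x) / Q T) ^ 2 * ‖G x‖ ^ 2 :=
          setIntegral_congr_fun Metric.isClosed_closedBall.measurableSet fun x hx => by
            simp only [hone x hx, one_pow, mul_one]
      _ ≤ _ := setIntegral_le_integral hfull (Eventually.of_forall fun x => by positivity)
  have hG0 : ∀ᵐ x, G x = 0 := by
    have hall : ∀ᵐ x : RN N, φ x ^ 2 * ‖G x‖ ^ 2 = 0 := by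
      rw [← Measure.restrict_univ (μ := volume), ← Metric.iUnion_closedBall_nat (0 : RN N),
        ae_restrict_iUnion_iff]
      exact hball
    filter_upwards [hall, hφ0] with x hx hx0
    simpa [hx0.ne'] using hx
  exact hσ.2.2.isAEConst hσ.1.locallyIntegrable hG0

/-! ### A nonconstant solution when `1 / Ψ'` is integrable -/

/-- The derivative of the one-dimensional bounded nonconstant solution. -/
theorem exists_profile {Ψ : ℝ → ℝ} (hΨ : ContDiffOn ℝ 1 Ψ (Ici 1))
    (hpos : ∀ R : ℝ, 1 ≤ R → 0 < Ψ R)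
    (hderiv : ∀ R : ℝ, 1 ≤ R → 0 < derivWithin Ψ (Ici 1) R)
    (hfin : ∫⁻ r in Ici (1 : ℝ), ENNReal.ofReal (1 / derivWithin Ψ (Ici 1) r) ≠ ⊤) :
    ∃ (p : ℝ → ℝ) (M K : ℝ), Continuous p ∧ (∀ t, 0 < p t) ∧ 0 ≤ K ∧
      (∀ t, |∫ s in (0 : ℝ)..t, p s| ≤ M) ∧
      ∀ R, 1 ≤ R → ∫ t in -R..R, 1 / p t ≤ K * Ψ R := by
  set d := derivWithin Ψ (Ici 1) with hd
  have hdc : ContinuousOn d (Ici 1) :=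
    hΨ.continuousOn_derivWithin (uniqueDiffOn_Ici 1) le_rfl
  -- The even extension of `Ψ'` to the line, constant on `[-1, 1]`.
  set D : ℝ → ℝ := fun t => d (max |t| 1) with hD
  have hDc : Continuous D := hdc.comp_continuous (by fun_prop) fun t => mem_Ici.2 (le_max_right _ _)
  have hD0 : ∀ t, 0 < D t := fun t => hderiv _ (le_max_right _ _)
  have hDneg : ∀ t, D (-t) = D t := fun t => by simp [hD]
  have hDd : ∀ t, 1 ≤ t → D t = d t := fun t ht => by
    simp [hD, abs_of_nonneg (zero_le_one.trans ht), ht]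
  have hD1 : ∀ t, |t| ≤ 1 → D t = d 1 := fun t ht => by simp [hD, ht]
  set p : ℝ → ℝ := fun t => 1 / D t with hp
  have hpc : Continuous p := continuous_const.div hDc fun t => (hD0 t).ne'
  have hp0 : ∀ t, 0 < p t := fun t => one_div_pos.2 (hD0 t)
  have hpneg : ∀ t, p (-t) = p t := fun t => by simp [hp, hDneg]
  have hint : IntegrableOn p (Ioi 0) := by
    rw [← Ioc_union_Ioi_eq_Ioi (zero_le_one (α := ℝ))]
    refine (hpc.integrableOn_Ioc).union ?_
    refine ⟨hpc.aestronglyMeasurable, ?_⟩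
    rw [hasFiniteIntegral_iff_ofReal (Eventually.of_forall fun t => (hp0 t).le)]
    refine lt_of_le_of_lt ?_ hfin.lt_top
    refine le_trans (setLIntegral_mono' measurableSet_Ioi fun t ht => ?_)
      (lintegral_mono_set Ioi_subset_Ici_self)
    simp only [hp, hDd t (le_of_lt ht), le_refl]
  have hnonneg : ∀ t, 0 ≤ t → |∫ s in (0 : ℝ)..t, p s| ≤ ∫ s in Ioi 0, p s := by
    intro t ht
    rw [abs_of_nonneg (intervalIntegral.integral_nonneg ht fun s _ => (hp0 s).le),
      intervalIntegral.integral_of_le ht]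
    exact setIntegral_mono_set hint (Eventually.of_forall fun s => (hp0 s).le)
      (LE.le.eventuallyLE Ioc_subset_Ioi_self)
  have h1 : 0 < d 1 := hderiv 1 le_rfl
  have hΨ1 : 0 < Ψ 1 := hpos 1 le_rfl
  -- By evenness `∫_{-R}^{R} D = 2 (Ψ'(1) + Ψ(R) - Ψ(1))`, and `Ψ'(1) ≤ (Ψ'(1)/Ψ(1)) Ψ(R)` since `Ψ`
  -- is increasing; this gives the constant `K`.
  refine ⟨p, ∫ s in Ioi 0, p s, 2 * (d 1 / Ψ 1 + 1), hpc, hp0, by positivity, fun t => ?_,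
    fun R hR => ?_⟩
  · rcases le_total 0 t with ht | ht
    · exact hnonneg t ht
    · have h2 : ∫ s in (0 : ℝ)..t, p s = -∫ s in (0 : ℝ)..(-t), p s := by
        have := intervalIntegral.integral_comp_neg (a := 0) (b := t) p
        simp only [hpneg, neg_zero] at this
        rw [this, intervalIntegral.integral_symm]
      rw [h2, abs_neg]
      exact hnonneg (-t) (by linarith)
  · have hpD : ∀ t, 1 / p t = D t := fun t => one_div_one_div _
    simp only [hpD]
    have hi : ∀ a b, IntervalIntegrable D volume a b := fun a b => hDc.intervalIntegrable a b
    have e1 : ∫ t in -R..(0 : ℝ), D t = ∫ t in (0 : ℝ)..R, D t := by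
      have := intervalIntegral.integral_comp_neg (a := 0) (b := R) D
      simp only [hDneg, neg_zero] at this
      exact this.symm
    have e2 : ∫ t in (0 : ℝ)..1, D t = d 1 := by
      rw [intervalIntegral.integral_congr (g := fun _ => d 1) fun t ht => ?_]
      · simp
      · rw [uIcc_of_le zero_le_one] at ht
        exact hD1 t (abs_le.2 ⟨by linarith [ht.1], ht.2⟩)
    have e3 : ∫ t in (1 : ℝ)..R, D t = Ψ R - Ψ 1 := by
      rw [← integral_derivWithin_Ici_one hΨ le_rfl hR]
      refine intervalIntegral.integral_congr fun t ht => ?_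
      rw [uIcc_of_le hR] at ht
      exact hDd t ht.1
    have e4 : 0 ≤ ∫ t in (1 : ℝ)..R, D t :=
      intervalIntegral.integral_nonneg hR fun t _ => (hD0 t).le
    rw [← intervalIntegral.integral_add_adjacent_intervals (hi (-R) 0) (hi 0 R), e1,
      ← intervalIntegral.integral_add_adjacent_intervals (hi 0 1) (hi 1 R), e2, e3]
    rw [e3] at e4
    have h3 : d 1 ≤ d 1 / Ψ 1 * Ψ R := by
      rw [div_mul_eq_mul_div, le_div_iff₀ hΨ1]
      exact mul_le_mul_of_nonneg_left (by linarith) h1.le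
    nlinarith

theorem Continuous.memLpLoc {F : Type} [NormedAddCommGroup F] {f : RN N → F}
    (hf : Continuous f) (p : ℝ≥0∞) : MemLpLoc f p := fun K hK => by
  have : IsFiniteMeasure (volume.restrict K) := ⟨by simpa using hK.measure_lt_top⟩
  exact (hf.memLp_top_of_isCompact hK).mono_exponent le_top

/-- The Gaussian in all the variables but the `j`-th. -/
noncomputable def transverseGaussian (j : Fin N) (x : RN N) : ℝ :=
  ∏ i ∈ Finset.univ.erase j, Real.exp (-1 * x i ^ 2)

theorem transverseGaussian_pos (j : Fin N) (x : RN N) : 0 < transverseGaussian j x :=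
  Finset.prod_pos fun _ _ => Real.exp_pos _

theorem continuous_transverseGaussian (j : Fin N) : Continuous (transverseGaussian j) :=
  continuous_finsetProd _ fun i _ => by fun_prop

theorem hasLineDerivAt_transverseGaussian (j : Fin N) (x : RN N) :
    HasLineDerivAt ℝ (transverseGaussian j) 0 x (EuclideanSpace.single j 1) := by
  have : (fun t : ℝ => transverseGaussian j (x + t • EuclideanSpace.single j 1)) =
      fun _ => transverseGaussian j x := by
    funext t
    refine Finset.prod_congr rfl fun i hi => ?_
    simp [Finset.ne_of_mem_erase hi]
  rw [HasLineDerivAt, this]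
  exact hasDerivAt_const _ _

/-- Integration by parts against a weight that does not depend on the `j`-th variable. -/
theorem integral_transverseGaussian_mul_fderiv (j : Fin N) {η : RN N → ℝ} (hη : IsTestFun η) :
    ∫ x, transverseGaussian j x * fderiv ℝ η x (EuclideanSpace.single j 1) = 0 := by
  have hc : Continuous fun x => fderiv ℝ η x (EuclideanSpace.single j 1) :=
    (hη.1.continuous_fderiv (by simp)).clm_apply continuous_const
  have hm := continuous_transverseGaussian j
  have h := integral_bilinear_hasLineDerivAt_right_eq_neg_left_of_integrable
    (μ := (volume : Measure (RN N))) (B := ContinuousLinearMap.mul ℝ ℝ)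
    (f := transverseGaussian j) (f' := fun _ => 0) (g := η)
    (g' := fun x => fderiv ℝ η x (EuclideanSpace.single j 1)) (v := EuclideanSpace.single j 1)
    (by simp)
    ((hm.mul hc).integrable_of_hasCompactSupport
      (hη.2.fderiv_apply (𝕜 := ℝ) (EuclideanSpace.single j 1)).mul_left)
    ((hm.mul hη.1.continuous).integrable_of_hasCompactSupport hη.2.mul_left)
    (fun x _ => hasLineDerivAt_transverseGaussian j x)
    (fun x _ => (hη.1.differentiable (by simp) x).hasFDerivAt.hasLineDerivAt _)
  simpa using h

/-- Fubini over the coordinates. It reduces the growth bound in dimension `N` to an integral in the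
single variable `x j`, at the price of a fixed finite factor. -/
theorem integrable_mul_transverseGaussian (j : Fin N) {f : ℝ → ℝ} (hf : Integrable f) :
    Integrable (fun x : RN N => f (x j) * transverseGaussian j x) ∧
    ∫ x : RN N, f (x j) * transverseGaussian j x =
      (∫ t, f t) * ∏ i ∈ (Finset.univ : Finset (Fin N)).erase j,
        ∫ t : ℝ, Real.exp (-1 * t ^ 2) := by
  set g : Fin N → ℝ → ℝ := fun i => if i = j then f else fun t => Real.exp (-1 * t ^ 2) with hg
  have hgi : ∀ i, Integrable (g i) := fun i => by
    by_cases h : i = j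
    · simpa [hg, h] using hf
    · simpa [hg, h] using integrable_exp_neg_mul_sq one_pos
  have hprod : ∀ y : Fin N → ℝ, ∏ i, g i (y i) =
      f (y j) * ∏ i ∈ Finset.univ.erase j, Real.exp (-1 * y i ^ 2) := fun y => by
    rw [← Finset.mul_prod_erase _ _ (Finset.mem_univ j)]
    congr 1
    · simp [hg]
    · exact Finset.prod_congr rfl fun i hi => by simp [hg, Finset.ne_of_mem_erase hi]
  have hmp := PiLp.volume_preserving_ofLp (Fin N)
  have hemb : MeasurableEmbedding (WithLp.ofLp : RN N → Fin N → ℝ) :=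
    (MeasurableEquiv.toLp 2 (Fin N → ℝ)).symm.measurableEmbedding
  have hcomp : (fun x : RN N => f (x j) * transverseGaussian j x) =
      (fun y : Fin N → ℝ => ∏ i, g i (y i)) ∘ WithLp.ofLp := by
    funext x
    simp only [Function.comp_apply, hprod]
    rfl
  constructor
  · rw [hcomp, hmp.integrable_comp_emb hemb]
    exact Integrable.fintype_prod hgi
  · rw [hcomp]
    change ∫ x : RN N, (fun y : Fin N → ℝ => ∏ i, g i (y i)) (WithLp.ofLp x) = _
    rw [hmp.integral_comp hemb (fun y : Fin N → ℝ => ∏ i, g i (y i)),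
      integral_fintype_prod_volume_eq_prod, ← Finset.mul_prod_erase _ _ (Finset.mem_univ j)]
    congr 1
    · simp [hg]
    · exact Finset.prod_congr rfl fun i hi => by simp [hg, Finset.ne_of_mem_erase hi]

/-- A `C¹` function of one coordinate has its classical gradient as weak gradient. -/
theorem isWeakGradient_comp_apply (j : Fin N) {u p : ℝ → ℝ} (hu : ∀ t, HasDerivAt u (p t) t)
    (hp : Continuous p) :
    IsWeakGradient (fun x : RN N => u (x j)) fun x => p (x j) • EuclideanSpace.single j 1 := by
  intro η hη v
  have huc : Continuous u := continuous_iff_continuousAt.2 fun t => (hu t).continuousAt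
  have hcoord : ∀ x : RN N, HasFDerivAt (fun x : RN N => x j)
      (EuclideanSpace.proj j : RN N →L[ℝ] ℝ) x := fun x =>
    (EuclideanSpace.proj j : RN N →L[ℝ] ℝ).hasFDerivAt
  have hd : ∀ x : RN N, HasFDerivAt (fun x : RN N => u (x j))
      (p (x j) • (EuclideanSpace.proj j : RN N →L[ℝ] ℝ)) x := fun x =>
    (hu (x j)).comp_hasFDerivAt x (hcoord x)
  have hf' : ∀ x : RN N, fderiv ℝ (fun x : RN N => u (x j)) x v =
      inner ℝ (p (x j) • (EuclideanSpace.single j 1 : RN N)) v := fun x => by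
    rw [(hd x).fderiv, inner_smul_left, EuclideanSpace.inner_single_left]
    simp
  have hcη : Continuous fun x => fderiv ℝ η x v :=
    (hη.1.continuous_fderiv (by simp)).clm_apply continuous_const
  have hcx : Continuous fun x : RN N => x j := by fun_prop
  have hG : Continuous fun x : RN N =>
      inner ℝ (p (x j) • (EuclideanSpace.single j 1 : RN N)) v :=
    ((hp.comp hcx).smul continuous_const).inner continuous_const
  have := integral_mul_fderiv_eq_neg_fderiv_mul_of_integrable (μ := (volume : Measure (RN N)))
    (f := fun x : RN N => u (x j)) (g := η) (v := v)
    (by simp only [hf']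
        exact (hG.mul hη.1.continuous).integrable_of_hasCompactSupport hη.2.mul_left)
    (((huc.comp hcx).mul hcη).integrable_of_hasCompactSupport
      (hη.2.fderiv_apply (𝕜 := ℝ) v).mul_left)
    (((huc.comp hcx).mul hη.1.continuous).integrable_of_hasCompactSupport hη.2.mul_left)
    (fun x _ => (hd x).differentiableAt) (fun x _ => hη.1.differentiable (by simp) x)
  simpa only [hf'] using this

/-- With `∇σ = p(x_j) e_j` and `φ²` proportional to `1/p(x_j)` times the transverse Gaussian, the
flux is a multiple of the Gaussian times `e_j`, hence divergence free. The Gaussian keeps the mass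
in the other directions finite. -/
theorem lintegral_eq_top_of_propertyP' {N : ℕ} (hN : 1 ≤ N) {Ψ : ℝ → ℝ}
    (hΨ : ContDiffOn ℝ 1 Ψ (Ici 1)) (hpos : ∀ R : ℝ, 1 ≤ R → 0 < Ψ R)
    (hderiv : ∀ R : ℝ, 1 ≤ R → 0 < derivWithin Ψ (Ici 1) R) (h : PropertyP' N Ψ) :
    ∫⁻ r in Ici (1 : ℝ), ENNReal.ofReal (1 / derivWithin Ψ (Ici 1) r) = ⊤ := by
  by_contra hfin
  obtain ⟨p, M, K, hpc, hp0, hK, hM, hpK⟩ := exists_profile hΨ hpos hderiv hfin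
  set j : Fin N := ⟨0, hN⟩
  set u : ℝ → ℝ := fun t => ∫ s in (0 : ℝ)..t, p s with hudef
  have hu : ∀ t, HasDerivAt u (p t) t := fun t =>
    intervalIntegral.integral_hasDerivAt_right (hpc.intervalIntegrable _ _)
      hpc.aestronglyMeasurable.stronglyMeasurableAtFilter hpc.continuousAt
  have huc : Continuous u := continuous_iff_continuousAt.2 fun t => (hu t).continuousAt
  have hcx : Continuous fun x : RN N => x j := by fun_prop
  set S : ℝ := ∏ i ∈ (Finset.univ : Finset (Fin N)).erase j, ∫ t : ℝ, Real.exp (-1 * t ^ 2)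
    with hS
  have hS0 : 0 ≤ S := Finset.prod_nonneg fun i _ => integral_nonneg fun t => (Real.exp_pos _).le
  -- Normalises the mass bound `a M² K S Ψ(R)` to at most `Ψ(R)`; the summand `1` keeps the
  -- denominator positive.
  set a : ℝ := 1 / (1 + M ^ 2 * K * S) with ha
  have ha0 : 0 < a := by positivity
  set φ : RN N → ℝ := fun x => √(a * (1 / p (x j)) * transverseGaussian j x) with hφ
  have hφpos : ∀ x, 0 < a * (1 / p (x j)) * transverseGaussian j x := fun x =>
    mul_pos (mul_pos ha0 (one_div_pos.2 (hp0 _))) (transverseGaussian_pos j x)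
  have hφsq : ∀ x, φ x ^ 2 = a * (1 / p (x j)) * transverseGaussian j x := fun x =>
    Real.sq_sqrt (hφpos x).le
  have hφc : Continuous φ := ((continuous_const.mul (continuous_const.div (hpc.comp hcx)
    fun x => (hp0 _).ne')).mul (continuous_transverseGaussian j)).sqrt
  have hσc : Continuous fun x : RN N => u (x j) := huc.comp hcx
  have hGc : Continuous fun x : RN N => p (x j) • (EuclideanSpace.single j 1 : RN N) :=
    (hpc.comp hcx).smul continuous_const
  have hdiv : DivEqZero φ fun x : RN N => p (x j) • EuclideanSpace.single j 1 := by
    intro η hη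
    have heq : ∀ x, φ x ^ 2 * inner ℝ (p (x j) • (EuclideanSpace.single j 1 : RN N))
        (gradient η x) =
        a * (transverseGaussian j x * fderiv ℝ η x (EuclideanSpace.single j 1)) := by
      intro x
      rw [inner_smul_left, real_inner_gradient_right, hφsq]
      have := (hp0 (x j)).ne'
      simp only [conj_trivial]
      field_simp
    simp only [heq]
    rw [integral_const_mul, integral_transverseGaussian_mul_fderiv j hη, mul_zero]
  have hgrowth : GrowthBound Ψ φ fun x => u (x j) := by
    intro R hR
    -- The ball lies in the slab `|x_j| < R`, over which the integral factorises.
    set f : ℝ → ℝ := (Ioc (-R) R).indicator fun t => M ^ 2 * (1 / p t) with hf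
    have hcp : Continuous fun t => M ^ 2 * (1 / p t) :=
      continuous_const.mul (continuous_const.div hpc fun t => (hp0 t).ne')
    have hfi : Integrable f :=
      (integrable_indicator_iff measurableSet_Ioc).2 hcp.integrableOn_Ioc
    have hf0 : ∀ t, 0 ≤ f t := indicator_nonneg fun t _ =>
      mul_nonneg (sq_nonneg _) (one_div_pos.2 (hp0 t)).le
    have hfint : ∫ t, f t ≤ M ^ 2 * (K * Ψ R) := by
      rw [integral_indicator measurableSet_Ioc, ← intervalIntegral.integral_of_le (by linarith),
        intervalIntegral.integral_const_mul]
      exact mul_le_mul_of_nonneg_left (hpK R hR) (sq_nonneg _)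
    obtain ⟨hi, hval⟩ := integrable_mul_transverseGaussian j hfi
    have hpt : ∀ x ∈ Metric.ball (0 : RN N) R, (φ x * u (x j)) ^ 2 ≤
        a * (f (x j) * transverseGaussian j x) := by
      intro x hx
      have hxj : |x j| < R :=
        (PiLp.norm_apply_le x j).trans_lt (mem_ball_zero_iff.1 hx)
      have hmem : x j ∈ Ioc (-R) R := ⟨(abs_lt.1 hxj).1, (abs_lt.1 hxj).2.le⟩
      have hu2 : u (x j) ^ 2 ≤ M ^ 2 := by
        rw [← sq_abs]
        exact pow_le_pow_left₀ (abs_nonneg _) (hM _) 2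
      rw [mul_pow, hφsq, hf, indicator_of_mem hmem]
      calc _ ≤ a * (1 / p (x j)) * transverseGaussian j x * M ^ 2 :=
            mul_le_mul_of_nonneg_left hu2 (hφpos x).le
        _ = _ := by ring
    calc ∫ x in Metric.ball (0 : RN N) R, (φ x * u (x j)) ^ 2
        ≤ ∫ x in Metric.ball (0 : RN N) R, a * (f (x j) * transverseGaussian j x) :=
          setIntegral_mono_on
            (((((hφc.mul hσc).pow 2).continuousOn.integrableOn_compact
              (isCompact_closedBall 0 R))).mono_set Metric.ball_subset_closedBall)
            (hi.const_mul a).integrableOn measurableSet_ball hpt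
      _ ≤ ∫ x, a * (f (x j) * transverseGaussian j x) :=
          setIntegral_le_integral (hi.const_mul a) (Eventually.of_forall fun x =>
            mul_nonneg ha0.le (mul_nonneg (hf0 _) (transverseGaussian_pos j x).le))
      _ ≤ a * (M ^ 2 * (K * Ψ R) * S) := by
          rw [integral_const_mul, hval]
          gcongr
      _ = M ^ 2 * K * S / (1 + M ^ 2 * K * S) * Ψ R := by rw [ha]; ring
      _ ≤ 1 * Ψ R := by
          have := hpos R hR
          gcongr
          exact (div_le_one (by positivity)).2 (by linarith)
      _ = Ψ R := one_mul _
  obtain ⟨c, hc⟩ := h φ (fun x => u (x j)) (fun x => p (x j) • EuclideanSpace.single j 1)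
    (hφc.memLpLoc _) (Eventually.of_forall fun x => Real.sqrt_pos.2 (hφpos x))
    ⟨hσc.memLpLoc _, hGc.memLpLoc _, isWeakGradient_comp_apply j hu hpc⟩ hdiv hgrowth
  -- Continuous functions that agree almost everywhere agree everywhere, so `u` would take equal
  -- values at `0` and `1`, although it is strictly increasing.
  have hall := (hσc.ae_eq_iff_eq volume (continuous_const (y := c))).1 hc
  have h0 : u 0 = c := by simpa using congrFun hall 0
  have h1 : u 1 = c := by simpa using congrFun hall (EuclideanSpace.single j 1)
  have hlt : u 0 < u 1 := strictMono_of_hasDerivAt_pos hu hp0 one_pos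
  exact hlt.ne (h0.trans h1.symm)

theorem theorem1p3 (N : ℕ) (hN : 1 ≤ N) (Ψ : ℝ → ℝ)
    (hΨ : ContDiffOn ℝ 1 Ψ (Set.Ici 1))
    (hpos : ∀ R : ℝ, 1 ≤ R → 0 < Ψ R)
    (hderiv : ∀ R : ℝ, 1 ≤ R → 0 < derivWithin Ψ (Set.Ici 1) R)
    (hconv : ∃ R₀ : ℝ, 1 < R₀ ∧ ConvexOn ℝ (Set.Ici R₀) Ψ) :
    List.TFAE [
      PropertyP N Ψ,
      PropertyP' N Ψ,
      ∫⁻ r in Set.Ici (1 : ℝ), ENNReal.ofReal (1 / derivWithin Ψ (Set.Ici 1) r) = (⊤ : ℝ≥0∞)] := by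
  obtain ⟨R₀, hR₀, hconv⟩ := hconv
  tfae_have 1 → 2 := fun h φ σ G hφ hφ0 hσ hdiv hg =>
    h φ σ G hφ hφ0 hσ (hdiv.mulDivNonneg hφ hσ) hg
  tfae_have 2 → 3 := lintegral_eq_top_of_propertyP' hN hΨ hpos hderiv
  tfae_have 3 → 1 := propertyP_of_lintegral_eq_top N hΨ hpos hderiv hR₀ hconv
  tfae_finish
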